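/- **Setting.** Let $\mathcal D\subseteq\mathbb R^2$ be open, bounded and simply connected, and let its boundary be a simple closed curve of length $\ell>0$ with an arclength parametrization $\mathbf c:\mathcal M\to\partial\mathcal D$, where $\mathcal M=[0,\ell]$ with $0$ and $\ell$ identified. Assume that $\mathbf c$ is piecewise $C^2$ (finitely many pieces, each $C^2$ up to its ends) and that the set of parameters at which the curvature of $\partial\mathcal D$ is defined and equal to zero is a union of finitely many intervals (single points count as intervals). Let $\mathcal F\subseteq\mathcal M$ be the (finite) set of parameters at which $\mathbf c$ is not differentiable. Let $\boldsymbol\chi:\bar{\mathcal D}\to\mathbb R^3$ be a $C^2$ isometric immersion, i.e. $\boldsymbol\chi$ is $C^2$ up to the boundary, locally injective, and $(\nabla\boldsymbol\chi)^{\top}\nabla\boldsymbol\chi=\mathbf 1$. **Rulings.** A *ruling* is a segment $[\mathbf p,\mathbf q]$ of positive length with $\mathbf p,\mathbf q\in\partial\mathcal D$ whose other points all lie in $\mathcal D$, such that $\nabla\nabla\boldsymbol\chi\neq 0$ at each point of the open segment and $\boldsymbol\chi$ maps $[\mathbf p,\mathbf q]$ to a straight segment. The curved region $\mathcal D_c$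 is the union of all rulings, endpoints included. Let $\mathcal A$ be the set of $\alpha\in\mathcal M$ such that there is exactly one ruling with endpoint $\mathbf c(\alpha)$. For $\alpha\in\mathcal A$, let $\hat\beta(\alpha)$ be the length of this ruling, let $\mathbf f(\alpha)$ be the unit vector along it that points from $\mathbf c(\alpha)$ into $\mathcal D$, and let $\mu(\alpha)\in\mathcal M$ be defined by $\mathbf c(\mu(\alpha))=\mathbf c(\alpha)+\hat\beta(\alpha)\mathbf f(\alpha)$. **The function $g_{\mathbf m}$.** Let $\mathbf d=\boldsymbol\chi\circ\mathbf c$. Off $\mathcal F$, let $\mathbf t=\mathbf d'$, let $\mathbf n$ be the unit normal of the image surface along $\mathbf d$ oriented so that $\mathbf m=\mathbf n\times\mathbf t$ points into the surface (i.e. $\mathbf m=\nabla\boldsymbol\chi\,\mathbf M$ with $\mathbf M$ the unit normal of $\partial\mathcal D$ that points into $\mathcal D$), and put $\mathbf g(\alpha)=\nabla\boldsymbol\chi(\mathbf c(\alpha))\mathbf f(\alpha)$ and $g_{\mathbf m}=\mathbf g\cdot\mathbf m$ for $\alpha\in\mathcal A\setminus\mathcal F$. Thus $g_{\mathbf m}(\alpha)=0$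 exactly if the ruling at $\mathbf c(\alpha)$ is tangent to $\partial\mathcal D$ there. Finally, let $$\hat{\mathcal A}=\{\alpha\in\mathcal A\setminus\mathcal F \mid \mu(\alpha)\in\mathcal A\setminus\mathcal F,\ g_{\mathbf m}(\alpha)\ne0,\ g_{\mathbf m}(\mu(\alpha))\ne0\},$$ $$\mathcal P(\hat{\mathcal A})=\{(\alpha,\beta)\mid \alpha\in\hat{\mathcal A},\ 0\le\beta\le\hat\beta(\alpha)\},\qquad \hat{\mathbf x}(\alpha,\beta)=\mathbf c(\alpha)+\beta\,\mathbf f(\alpha).$$ **Proposition.** 1. The set $\{\alpha\in\mathcal A\setminus\mathcal F\mid g_{\mathbf m}(\alpha)=0\}$ is finite. 2. The set $\hat{\mathbf x}(\mathcal P(\hat{\mathcal A}))$ is contained in $\mathcal D_c$, and $\mathcal D_c\setminus\hat{\mathbf x}(\mathcal P(\hat{\mathcal A}))$ has zero area (two-dimensional Lebesgue measure). -/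

import Mathlib

open Set Filter Topology MeasureTheory

namespace RuledImmersion

/-- The plane that contains the reference region, and the ambient three-dimensional space. -/
abbrev Plane : Type := EuclideanSpace ℝ (Fin 2)

abbrev Space : Type := EuclideanSpace ℝ (Fin 3)

/-- Rotation of the plane by a right angle. -/
noncomputable def rot (v : Plane) : Plane := !₂[-(v 1), v 0]

/-- The vector product of the ambient space. -/
noncomputable def cross (u v : Space) : Space :=
  WithLp.toLp 2 (crossProduct (WithLp.ofLp u) (WithLp.ofLp v))

/-- `D` is an open, bounded, simply connected plane region whose boundary is a simple closed curve
of length `ℓ`, with arclength parametrization `c`. The parameter set `[0, ℓ]` with `0` and `ℓ`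
identified is realised by taking `c` to be `ℓ`-periodic on `ℝ`, with fundamental domain `[0, ℓ)`.
The boundary is piecewise `C²` (up to the ends of each piece), and the set of parameters at which
its curvature is defined and equal to zero is a union of finitely many intervals
(single points count as intervals). -/
structure IsReferenceRegion (D : Set Plane) (ℓ : ℝ) (c : ℝ → Plane) : Prop where
  isOpen : IsOpen D
  isBounded : Bornology.IsBounded D
  simplyConnected : SimplyConnectedSpace D
  length_pos : 0 < ℓ
  continuous : Continuous c
  periodic : Function.Periodic c ℓ
  injOn : InjOn c (Ico 0 ℓ)
  image_eq : c '' Ico 0 ℓ = frontier D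
  piecewise_C2 : ∃ (n : ℕ) (t : ℕ → ℝ), StrictMono t ∧ t 0 = 0 ∧ t n = ℓ ∧
    ∀ i < n, ContDiffOn ℝ 2 c (Icc (t i) (t (i + 1)))
  arclength : ∀ α : ℝ, DifferentiableAt ℝ c α → ‖deriv c α‖ = 1
  curvature_zeros : ∃ S : Set (Set ℝ), S.Finite ∧ (∀ I ∈ S, I.OrdConnected) ∧
    {α ∈ Ico 0 ℓ | ContDiffAt ℝ 2 c α ∧ deriv (deriv c) α = 0} = ⋃₀ S

/-- `χ` is a `C²` isometric immersion of the closure of `D`: it is of class `C²` up to the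
boundary, locally injective, and its gradient preserves lengths. (The gradient is continuous up to
the boundary, so that this last condition need only be imposed in `D`.) -/
structure IsIsometricImmersion (D : Set Plane) (χ : Plane → Space) : Prop where
  contDiffOn : ContDiffOn ℝ 2 χ (closure D)
  locallyInjective : ∀ x ∈ closure D, ∃ U ∈ 𝓝[closure D] x, InjOn χ U
  isometric : ∀ x ∈ D, ∀ v : Plane, ‖fderiv ℝ χ x v‖ = ‖v‖

/-- The segment from `p` to `q` is a reference ruling: it has positive length, its endpoints lie on
the boundary of `D` and all its other points lie in `D`, the second derivative of `χ` does not
vanish at any point of it inside `D`, and `χ` maps it to a straight segment (a straight curve on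
a surface is always an asymptotic curve). -/
structure IsRuling (D : Set Plane) (χ : Plane → Space) (p q : Plane) : Prop where
  ne : p ≠ q
  left_mem : p ∈ frontier D
  right_mem : q ∈ frontier D
  interior_subset : openSegment ℝ p q ⊆ D
  curved : ∀ x ∈ openSegment ℝ p q, fderiv ℝ (fderiv ℝ χ) x ≠ 0
  straight : ∀ s ∈ Icc (0 : ℝ) 1,
    χ (AffineMap.lineMap p q s) = AffineMap.lineMap (χ p) (χ q) s

/-- `D_c`: the union of all the rulings, endpoints included. -/
def curvedPart (D : Set Plane) (χ : Plane → Space) : Set Plane :=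
  {x | ∃ p q, IsRuling D χ p q ∧ x ∈ segment ℝ p q}

/-- `F`: the parameters at which the boundary curve is not differentiable. -/
def singularSet (ℓ : ℝ) (c : ℝ → Plane) : Set ℝ :=
  {α ∈ Ico 0 ℓ | ¬ DifferentiableAt ℝ c α}

/-- `A`: the parameters `α` such that exactly one ruling has the endpoint `c α`. -/
def rulingSet (D : Set Plane) (χ : Plane → Space) (ℓ : ℝ) (c : ℝ → Plane) : Set ℝ :=
  {α ∈ Ico 0 ℓ | ∃! q, IsRuling D χ (c α) q}

/-- The other endpoint of the ruling with endpoint `c α`. It is used only for `α` in `A`. -/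
noncomputable def otherEnd (D : Set Plane) (χ : Plane → Space) (c : ℝ → Plane) (α : ℝ) : Plane :=
  Classical.epsilon fun q => IsRuling D χ (c α) q

/-- The length `β̂(α)` of the ruling with endpoint `c α`. -/
noncomputable def rulingLength (D : Set Plane) (χ : Plane → Space) (c : ℝ → Plane) (α : ℝ) : ℝ :=
  ‖otherEnd D χ c α - c α‖

/-- The unit vector `f(α)` directed from `c α` into `D` along the ruling with endpoint `c α`. -/
noncomputable def rulingDir (D : Set Plane) (χ : Plane → Space) (c : ℝ → Plane) (α : ℝ) : Plane :=
  (rulingLength D χ c α)⁻¹ • (otherEnd D χ c α - c α)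

/-- `μ(α)`: the parameter in `[0, ℓ)` with `c (μ α) = c α + β̂(α) f(α)`. -/
noncomputable def mu (D : Set Plane) (χ : Plane → Space) (ℓ : ℝ) (c : ℝ → Plane) (α : ℝ) : ℝ :=
  Function.invFunOn c (Ico 0 ℓ) (c α + rulingLength D χ c α • rulingDir D χ c α)

/-- The parametrization `x̂(α, β) = c(α) + β f(α)`. -/
noncomputable def xHat (D : Set Plane) (χ : Plane → Space) (c : ℝ → Plane) (P : ℝ × ℝ) : Plane :=
  c P.1 + P.2 • rulingDir D χ c P.1

/-- `P(A')`: the pairs `(α, β)` with `α ∈ A'` and `0 ≤ β ≤ β̂(α)`. -/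
def paramSet (D : Set Plane) (χ : Plane → Space) (c : ℝ → Plane) (A' : Set ℝ) : Set (ℝ × ℝ) :=
  {P | P.1 ∈ A' ∧ P.2 ∈ Icc 0 (rulingLength D χ c P.1)}

open Classical in
/-- `M(α)`: the unit normal of the boundary of `D` at `c α` that points into `D`. -/
noncomputable def inwardNormal (D : Set Plane) (c : ℝ → Plane) (α : ℝ) : Plane :=
  if ∀ᶠ ε in 𝓝[>] (0 : ℝ), c α + ε • rot (deriv c α) ∈ D
  then rot (deriv c α) else -rot (deriv c α)

/-- The gradient of `χ` at the boundary point `c α`. -/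
noncomputable def bdryGrad (D : Set Plane) (χ : Plane → Space) (c : ℝ → Plane) (α : ℝ) :
    Plane →L[ℝ] Space :=
  fderivWithin ℝ χ (closure D) (c α)

/-- The Darboux frame `(t, m, n)` of the curve `d = χ ∘ c` on the image surface. First the unit
tangent `t = d'`. -/
noncomputable def darbouxT (χ : Plane → Space) (c : ℝ → Plane) (α : ℝ) : Space :=
  deriv (χ ∘ c) α

/-- The unit normal `n` of the image surface, oriented so that `n × t` points into the surface. -/
noncomputable def darbouxN (D : Set Plane) (χ : Plane → Space) (c : ℝ → Plane) (α : ℝ) : Space :=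
  cross (bdryGrad D χ c α (deriv c α)) (bdryGrad D χ c α (inwardNormal D c α))

/-- The conormal `m = n × t`. -/
noncomputable def darbouxM (D : Set Plane) (χ : Plane → Space) (c : ℝ → Plane) (α : ℝ) : Space :=
  cross (darbouxN D χ c α) (darbouxT χ c α)

/-- The direction `g(α) = ∇χ(c α) f(α)` of the image ruling. -/
noncomputable def imageDir (D : Set Plane) (χ : Plane → Space) (c : ℝ → Plane) (α : ℝ) : Space :=
  bdryGrad D χ c α (rulingDir D χ c α)

/-- The component `g_m` of `g = g_t t + g_m m`. -/
noncomputable def gm (D : Set Plane) (χ : Plane → Space) (c : ℝ → Plane) (α : ℝ) : ℝ :=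
  inner ℝ (imageDir D χ c α) (darbouxM D χ c α)

/-- `Â`: the `α ∈ A ∖ F` with `μ(α) ∉ F`, `g_m(α) ≠ 0` and `g_m(μ(α)) ≠ 0`. As `g_m` is
a function on `A`, the last condition includes that `μ(α) ∈ A`. -/
def regularSet (D : Set Plane) (χ : Plane → Space) (ℓ : ℝ) (c : ℝ → Plane) : Set ℝ :=
  {α | α ∈ rulingSet D χ ℓ c \ singularSet ℓ c ∧ gm D χ c α ≠ 0 ∧
    mu D χ ℓ c α ∈ rulingSet D χ ℓ c \ singularSet ℓ c ∧ gm D χ c (mu D χ ℓ c α) ≠ 0}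

end RuledImmersion

open RuledImmersion

/-! ### The second derivative of an isometric immersion: normality, Gauss equation, rank one. -/

namespace RuledImmersion

variable {D : Set Plane} {χ : Plane → Space}

/-! The second derivative of an isometric immersion is normal to the surface, so its values are
multiples of one vector, and the Gauss equation (`gauss`) makes this form of rank at most one. Where
it is nonzero, the argument of Hartman and Nirenberg applies: the gradient is constant along the
line in the kernel direction, and the reciprocal of the second derivative across that line is affine
(`hessian_along_kernel`, `hess_kernel_segment`). An affine function is bounded on a segment, so the
second derivative cannot fade out at the end of a ruling (`boundary_hess`). Hence the rulings at a
boundary point follow the kernel of a nonzero limit form: there are at most two, and two are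
opposite (`parallel`, `eq_of_pos`).

Off a finite set (breaks and ends of the zero-curvature intervals) the boundary is `C²` and either
curved or locally straight. A ruling tangent to a straight part would run inside the boundary. A
ruling tangent at a curved point bounds a half disc in `D`, and the limit of nearby rulings
continues it beyond the point of tangency (`exists_opposite`). So, off the finite set, a unique
ruling is transverse; this is the first claim.

For the second claim, every missing point lies on a ruling with a bad end. Off the finite set, a bad
end carries two opposite rulings. They are tangent to the boundary, for otherwise `D` would lie on
both sides of it, against the jump of the winding number (`not_both_sides`). Such parameters are
isolated: two neighbouring tangent lines would cross in `D`, where two kernel directions annihilate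
the second derivative (`isolated_of_mem_tangentSet`). So the bad ends are countable, each carries at
most two rulings, and segments are null sets. -/

theorem IsIsometricImmersion.contDiffAt (hχ : IsIsometricImmersion D χ) (hD : IsOpen D)
    {x : Plane} (hx : x ∈ D) : ContDiffAt ℝ 2 χ x :=
  (hχ.contDiffOn.mono subset_closure).contDiffAt (hD.mem_nhds hx)

theorem IsIsometricImmersion.contDiffAt_fderiv (hχ : IsIsometricImmersion D χ) (hD : IsOpen D)
    {x : Plane} (hx : x ∈ D) : ContDiffAt ℝ 1 (fderiv ℝ χ) x :=
  (hχ.contDiffAt hD hx).fderiv_right (by norm_num)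

theorem IsIsometricImmersion.hasFDerivAt (hχ : IsIsometricImmersion D χ) (hD : IsOpen D)
    {x : Plane} (hx : x ∈ D) : HasFDerivAt χ (fderiv ℝ χ x) x :=
  ((hχ.contDiffAt hD hx).differentiableAt (by norm_num)).hasFDerivAt

theorem IsIsometricImmersion.hasFDerivAt_fderiv (hχ : IsIsometricImmersion D χ) (hD : IsOpen D)
    {x : Plane} (hx : x ∈ D) : HasFDerivAt (fderiv ℝ χ) (fderiv ℝ (fderiv ℝ χ) x) x :=
  ((hχ.contDiffAt_fderiv hD hx).differentiableAt (by norm_num)).hasFDerivAt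

theorem IsIsometricImmersion.continuousAt_hess (hχ : IsIsometricImmersion D χ) (hD : IsOpen D)
    {x : Plane} (hx : x ∈ D) : ContinuousAt (fderiv ℝ (fderiv ℝ χ)) x :=
  ((hχ.contDiffAt_fderiv hD hx).fderiv_right (m := 0) (by norm_num)).continuousAt

theorem IsIsometricImmersion.hess_symm (hχ : IsIsometricImmersion D χ) (hD : IsOpen D)
    {x : Plane} (hx : x ∈ D) (h k : Plane) :
    fderiv ℝ (fderiv ℝ χ) x h k = fderiv ℝ (fderiv ℝ χ) x k h :=
  second_derivative_symmetric_of_eventually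
    ((hD.eventually_mem hx).mono fun _ hy => hχ.hasFDerivAt hD hy)
    (hχ.hasFDerivAt_fderiv hD hx) h k

theorem inner_map_of_norm_map {G : Plane →L[ℝ] Space} (hG : ∀ v, ‖G v‖ = ‖v‖) (u v : Plane) :
    inner ℝ (G u) (G v) = inner ℝ u v :=
  LinearIsometry.inner_map_map (⟨G.toLinearMap, hG⟩ : Plane →ₗᵢ[ℝ] Space) u v

/-- Differentiating the constant metric gives an antisymmetry in `u` and `v`; with the symmetry of
the second derivative, three cyclic copies cancel as in the computation of Christoffel symbols. -/
theorem IsIsometricImmersion.inner_fderiv_hess (hχ : IsIsometricImmersion D χ) (hD : IsOpen D)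
    {x : Plane} (hx : x ∈ D) (u h v : Plane) :
    inner ℝ (fderiv ℝ χ x u) (fderiv ℝ (fderiv ℝ χ) x h v) = 0 := by
  have anti : ∀ u h v : Plane, inner ℝ (fderiv ℝ χ x u) (fderiv ℝ (fderiv ℝ χ) x h v)
      + inner ℝ (fderiv ℝ (fderiv ℝ χ) x h u) (fderiv ℝ χ x v) = 0 := by
    intro u h v
    have h1 : ∀ z : Plane, HasFDerivAt (fun y => fderiv ℝ χ y z)
        ((ContinuousLinearMap.apply ℝ Space z).comp (fderiv ℝ (fderiv ℝ χ) x)) x := fun z =>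
      (ContinuousLinearMap.apply ℝ Space z).hasFDerivAt.comp x (hχ.hasFDerivAt_fderiv hD hx)
    have h2 := (h1 u).inner ℝ (h1 v)
    have h3 : HasFDerivAt (fun y => inner ℝ (fderiv ℝ χ y u) (fderiv ℝ χ y v))
        (0 : Plane →L[ℝ] ℝ) x := by
      refine (hasFDerivAt_const (inner ℝ u v) x).congr_of_eventuallyEq ?_
      filter_upwards [hD.eventually_mem hx] with y hy
      exact inner_map_of_norm_map (hχ.isometric y hy) u v
    have h4 := congrArg (fun L => L h) (h2.unique h3)
    simpa using h4
  have a1 := anti u h v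
  have a2 := anti v u h
  have a3 := anti h v u
  rw [real_inner_comm] at a1 a2 a3
  simp only [hχ.hess_symm hD hx h u, hχ.hess_symm hD hx v u, hχ.hess_symm hD hx v h,
    real_inner_comm] at *
  linarith

/-- The usual proof needs third derivatives. Here the tangent vector at `x` is frozen in `y ↦ ⟪G x
u, G y v⟫`; by normality the first derivative acquires a factor that vanishes at `x`, so this
function is twice differentiable there although `χ` is only `C²`. The identity is the symmetry of
its second derivative. -/
theorem IsIsometricImmersion.gauss (hχ : IsIsometricImmersion D χ) (hD : IsOpen D)
    {x : Plane} (hx : x ∈ D) (k u h v : Plane) :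
    inner ℝ (fderiv ℝ (fderiv ℝ χ) x k u) (fderiv ℝ (fderiv ℝ χ) x h v) =
      inner ℝ (fderiv ℝ (fderiv ℝ χ) x h u) (fderiv ℝ (fderiv ℝ χ) x k v) := by
  set G := fderiv ℝ χ
  set H := fderiv ℝ G
  have hG : ∀ z y : Plane, y ∈ D → HasFDerivAt (fun y => G y z)
      ((ContinuousLinearMap.apply ℝ Space z).comp (H y)) y := fun z y hy =>
    (ContinuousLinearMap.apply ℝ Space z).hasFDerivAt.comp y (hχ.hasFDerivAt_fderiv hD hy)
  -- the derivative of `y ↦ ⟪G x u, G y v⟫`, written so as to vanish at `x`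
  let B : Plane → (Plane →L[ℝ] Space) := fun y => (ContinuousLinearMap.apply ℝ Space v).comp (H y)
  let q' : Plane → (Plane →L[ℝ] ℝ) := fun y => (innerSL ℝ (G x u - G y u)).comp (B y)
  let q'' : Plane →L[ℝ] Plane →L[ℝ] ℝ :=
    -((ContinuousLinearMap.compL ℝ Plane Space ℝ).flip (B x)).comp
      ((innerSL ℝ).comp ((ContinuousLinearMap.apply ℝ Space u).comp (H x)))
  have hq : ∀ᶠ y in 𝓝 x, HasFDerivAt (fun y => inner ℝ (G x u) (G y v)) (q' y) y := by
    filter_upwards [hD.eventually_mem hx] with y hy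
    have := (innerSL ℝ (G x u)).hasFDerivAt.comp y (hG v y hy)
    refine this.congr_fderiv ?_
    ext1 h
    have h0 := hχ.inner_fderiv_hess hD hy u h v
    simp only [ContinuousLinearMap.comp_apply, innerSL_apply_apply, ContinuousLinearMap.apply_apply,
      inner_sub_left, q', B]
    linarith
  have hq' : HasFDerivAt q' q'' x := by
    have hBc : ContinuousAt B x :=
      (ContinuousLinearMap.compL ℝ Plane (Plane →L[ℝ] Space) Space
        (ContinuousLinearMap.apply ℝ Space v)).continuous.continuousAt.comp
        (hχ.continuousAt_hess hD hx)
    have h1 := hG u x hx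
    rw [hasFDerivAt_iff_isLittleO] at h1 ⊢
    have hO : (fun y => G y u - G x u) =O[𝓝 x] fun y => y - x := (hG u x hx).isBigO_sub
    -- `H` is merely continuous, so the remainder is split into a product of the increments of `G`
    -- and `H`, and the first-order remainder of `G` times the value of `H` at `x`.
    have e : ∀ y, q' y - q' x - q'' (y - x) =
        (innerSL ℝ (-(G y u - G x u))).comp (B y - B x) +
          (innerSL ℝ (-(G y u - G x u - H x (y - x) u))).comp (B x) := by
      intro y
      ext h
      simp [q', q'']
      abel
    have h2 : (fun y => (innerSL ℝ (-(G y u - G x u))).comp (B y - B x)) =o[𝓝 x]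
        fun y => y - x := by
      have hB : (fun y => B y - B x) =o[𝓝 x] (fun _ => (1 : ℝ)) := by
        rw [Asymptotics.isLittleO_one_iff]
        simpa using (hBc.tendsto.sub_const (B x))
      have := hO.norm_norm.mul_isLittleO hB.norm_left
      refine Asymptotics.IsBigO.trans_isLittleO
        (g := fun y => ‖G y u - G x u‖ * ‖B y - B x‖) ?_
        (this.trans_isBigO ?_)
      · refine Asymptotics.IsBigO.of_bound 1 (Eventually.of_forall fun y => ?_)
        refine (ContinuousLinearMap.opNorm_comp_le _ _).trans ?_
        rw [innerSL_apply_norm, norm_neg, one_mul, Real.norm_eq_abs]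
        exact le_abs_self _
      · simpa using (Asymptotics.isBigO_refl (fun y => y - x) (𝓝 x)).norm_left
    have h3 : (fun y => (innerSL ℝ (-(G y u - G x u - H x (y - x) u))).comp (B x)) =o[𝓝 x]
        fun y => y - x := by
      refine Asymptotics.IsBigO.trans_isLittleO (g := fun y => G y u - G x u - H x (y - x) u) ?_ h1
      refine Asymptotics.IsBigO.of_bound ‖B x‖ (Eventually.of_forall fun y => ?_)
      refine (ContinuousLinearMap.opNorm_comp_le _ _).trans ?_
      rw [innerSL_apply_norm, norm_neg, mul_comm]
    exact (h2.add h3).congr_left fun y => (e y).symm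
  have := second_derivative_symmetric_of_eventually hq hq' k h
  simpa [q'', B] using this

/-- All values lie in the orthogonal complement of the tangent plane, which is a line. -/
theorem IsIsometricImmersion.hess_collinear (hχ : IsIsometricImmersion D χ) (hD : IsOpen D)
    {x : Plane} (hx : x ∈ D) {h k : Plane} (hne : fderiv ℝ (fderiv ℝ χ) x h k ≠ 0)
    (h' k' : Plane) :
    ∃ r : ℝ, r • fderiv ℝ (fderiv ℝ χ) x h k = fderiv ℝ (fderiv ℝ χ) x h' k' := by
  set G : Plane →ₗ[ℝ] Space := (fderiv ℝ χ x).toLinearMap with hGdef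
  have hinj : Function.Injective G := by
    rw [injective_iff_map_eq_zero]
    intro v hv
    have := hχ.isometric x hx v
    rw [show fderiv ℝ χ x v = 0 from hv, norm_zero] at this
    exact norm_eq_zero.1 this.symm
  have hr : Module.finrank ℝ (LinearMap.range G) = 2 := by
    rw [LinearMap.finrank_range_of_inj hinj]; simp
  have hr' : Module.finrank ℝ (LinearMap.range G)ᗮ = 1 := by
    have := (LinearMap.range G).finrank_add_finrank_orthogonal
    rw [hr] at this
    simp at this
    omega
  have hm : ∀ a b : Plane, fderiv ℝ (fderiv ℝ χ) x a b ∈ (LinearMap.range G)ᗮ := by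
    rintro a b _ ⟨u, rfl⟩
    exact hχ.inner_fderiv_hess hD hx u a b
  obtain ⟨r, hr⟩ := (finrank_eq_one_iff_of_nonzero'
    (⟨_, hm h k⟩ : (LinearMap.range G)ᗮ) (by simpa [Subtype.ext_iff] using hne)).1 hr' ⟨_, hm h' k'⟩
  exact ⟨r, by simpa [Subtype.ext_iff] using hr⟩

/-- The Gauss equation bounds a semidefinite rank-one form: the square of the mixed entry is the
product of the diagonal ones. -/
theorem IsIsometricImmersion.hess_eq_zero_of_diag (hχ : IsIsometricImmersion D χ) (hD : IsOpen D)
    {x : Plane} (hx : x ∈ D) {d : Plane} (h : fderiv ℝ (fderiv ℝ χ) x d d = 0) :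
    fderiv ℝ (fderiv ℝ χ) x d = 0 := by
  ext1 w
  have := hχ.gauss hD hx d w w d
  rw [h, inner_zero_right, hχ.hess_symm hD hx w d] at this
  simpa using this

/-- Collinearity lets one nonzero component decide for the whole vector, so the mixed entry
vanishes; the Gauss equation then kills the entry at `v, v`. -/
theorem IsIsometricImmersion.hess_eq_zero_of_inner (hχ : IsIsometricImmersion D χ) (hD : IsOpen D)
    {x : Plane} (hx : x ∈ D) {a : Space} {v w : Plane}
    (h1 : inner ℝ a (fderiv ℝ (fderiv ℝ χ) x w w) ≠ 0)
    (h2 : inner ℝ a (fderiv ℝ (fderiv ℝ χ) x v w) = 0) :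
    fderiv ℝ (fderiv ℝ χ) x v = 0 := by
  have hne : fderiv ℝ (fderiv ℝ χ) x w w ≠ 0 := fun h => h1 (by rw [h, inner_zero_right])
  obtain ⟨r, hr⟩ := hχ.hess_collinear hD hx hne v w
  have hvw : fderiv ℝ (fderiv ℝ χ) x v w = 0 := by
    rw [← hr, inner_smul_right] at h2
    rw [← hr, (mul_eq_zero.1 h2).resolve_right h1, zero_smul]
  refine hχ.hess_eq_zero_of_diag hD hx ?_
  obtain ⟨r', hr'⟩ := hχ.hess_collinear hD hx hne v v
  have := hχ.gauss hD hx v v w w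
  rw [hvw, inner_zero_right, ← hr', inner_smul_left] at this
  have h0 : r' = 0 := (mul_eq_zero.1 this).resolve_right (by simpa using hne)
  rw [← hr', h0, zero_smul]

theorem exists_eq_smul_add_smul_rot {v : Plane} (hv : v ≠ 0) (z : Plane) :
    ∃ a b : ℝ, z = a • v + b • rot v := by
  have h : v 0 ^ 2 + v 1 ^ 2 ≠ 0 := by
    intro h
    refine hv ?_
    ext i
    fin_cases i <;> simp <;> nlinarith [sq_nonneg (v 0), sq_nonneg (v 1)]
  refine ⟨(v 0 * z 0 + v 1 * z 1) / (v 0 ^ 2 + v 1 ^ 2),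
    (v 0 * z 1 - v 1 * z 0) / (v 0 ^ 2 + v 1 ^ 2), ?_⟩
  ext i
  fin_cases i
  · simp only [rot, Fin.zero_eta, PiLp.add_apply, PiLp.smul_apply, smul_eq_mul,
      Matrix.cons_val_zero]
    generalize v 0 = a at *
    generalize v 1 = b at *
    field_simp
    ring
  · simp only [rot, Fin.mk_one, PiLp.add_apply, PiLp.smul_apply, smul_eq_mul,
      Matrix.cons_val_one, Matrix.cons_val_fin_one]
    generalize v 0 = a at *
    generalize v 1 = b at *
    field_simp
    ring

/-- A bilinear map on the plane that has `v` in its kernel and vanishes on the diagonal at `rot v`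
is zero. -/
theorem hess_eq_zero_of_rot {B : Plane →L[ℝ] Plane →L[ℝ] Space} (hs : ∀ h k, B h k = B k h)
    {v : Plane} (hv : v ≠ 0) (h : B v = 0) (h' : B (rot v) (rot v) = 0) : B = 0 := by
  have h1 : B (rot v) v = 0 := by rw [hs, h]; rfl
  ext1 x
  ext1 y
  obtain ⟨a, b, rfl⟩ := exists_eq_smul_add_smul_rot hv x
  obtain ⟨a', b', rfl⟩ := exists_eq_smul_add_smul_rot hv y
  simp [h, h1, h']

end RuledImmersion

/-! ### Scalar functions with degenerate Hessian. -/

namespace RuledImmersion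

/-- The inverse function theorem for `(x, y) ↦ (A, y)`: the value of `A` replaces the first
coordinate. -/
theorem exists_implicit_solution {A : ℝ × ℝ → ℝ} (hA : ContDiffAt ℝ 1 A 0)
    (h1 : fderiv ℝ A 0 (1, 0) ≠ 0) :
    ∃ X : ℝ × ℝ → ℝ, ContDiffAt ℝ 1 X (A 0, 0) ∧ X (A 0, 0) = 0 ∧
      ∀ᶠ z in 𝓝 (A 0, (0 : ℝ)), A (X z, z.2) = z.1 := by
  let Φ : ℝ × ℝ → ℝ × ℝ := fun z => (A z, z.2)
  let L : ℝ × ℝ →L[ℝ] ℝ × ℝ := (fderiv ℝ A 0).prod (ContinuousLinearMap.snd ℝ ℝ ℝ)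
  have hinj : Function.Injective L.toLinearMap := by
    rw [injective_iff_map_eq_zero]
    rintro ⟨p, q⟩ h
    have hq : q = 0 := congrArg Prod.snd h
    have hp : fderiv ℝ A 0 (p, q) = 0 := congrArg Prod.fst h
    rw [hq, show ((p, (0 : ℝ)) : ℝ × ℝ) = p • (1, 0) by simp, map_smul, smul_eq_mul] at hp
    rw [hq, (mul_eq_zero.1 hp).resolve_right h1]
    rfl
  let e : (ℝ × ℝ) ≃L[ℝ] (ℝ × ℝ) :=
    (LinearEquiv.ofInjectiveEndo L.toLinearMap hinj).toContinuousLinearEquiv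
  have he : (e : ℝ × ℝ →L[ℝ] ℝ × ℝ) = L := ContinuousLinearMap.ext fun _ => rfl
  have hΦ : ContDiffAt ℝ 1 Φ 0 := hA.prodMk contDiffAt_snd
  have hΦ' : HasFDerivAt Φ (e : ℝ × ℝ →L[ℝ] ℝ × ℝ) 0 := by
    rw [he]
    exact (hA.differentiableAt one_ne_zero).hasFDerivAt.prodMk hasFDerivAt_snd
  have h0 : Φ 0 = (A 0, 0) := rfl
  have hΨ := hΦ.to_localInverse hΦ' one_ne_zero
  have hΨ0 := hΦ.localInverse_apply_image hΦ' one_ne_zero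
  have hr := (hΦ.hasStrictFDerivAt' hΦ' one_ne_zero).eventually_right_inverse
  rw [h0] at hΨ hΨ0 hr
  refine ⟨fun z => (hΦ.localInverse hΦ' one_ne_zero z).1, hΨ.fst, by simp [hΨ0], ?_⟩
  filter_upwards [hr] with z hz
  change Φ (hΦ.localInverse hΦ' one_ne_zero z) = z at hz
  have e2 : (hΦ.localInverse hΦ' one_ne_zero z).2 = z.2 :=
    (congrArg Prod.snd hz : (Φ _).2 = z.2)
  have e1 : A (hΦ.localInverse hΦ' one_ne_zero z) = z.1 :=
    (congrArg Prod.fst hz : (Φ _).1 = z.1)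
  rw [← e2]
  exact e1

theorem hasDerivAt_slice_fst {f : ℝ × ℝ → ℝ} {f' : ℝ × ℝ →L[ℝ] ℝ} {u η : ℝ}
    (h : HasFDerivAt f f' (u, η)) : HasDerivAt (fun u => f (u, η)) (f' (1, 0)) u :=
  h.comp_hasDerivAt u ((hasDerivAt_id u).prodMk (hasDerivAt_const u η))

theorem hasDerivAt_slice_snd {f : ℝ × ℝ → ℝ} {f' : ℝ × ℝ →L[ℝ] ℝ} {u η : ℝ}
    (h : HasFDerivAt f f' (u, η)) : HasDerivAt (fun η => f (u, η)) (f' (0, 1)) η :=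
  h.comp_hasDerivAt η ((hasDerivAt_const η u).prodMk (hasDerivAt_id η))

theorem eq_of_hasDerivAt_zero {f : ℝ → ℝ} {ε : ℝ} (h : ∀ s, |s| < ε → HasDerivAt f 0 s)
    {s t : ℝ} (hs : |s| < ε) (ht : |t| < ε) : f s = f t := by
  refine isOpen_Ioo.is_const_of_deriv_eq_zero (s := Ioo (-ε) ε) isPreconnected_Ioo
    (fun x hx => (h x (abs_lt.2 hx)).differentiableAt.differentiableWithinAt)
    (fun x hx => (h x (abs_lt.2 hx)).deriv) (abs_lt.1 hs) (abs_lt.1 ht)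

/-- For a `C²` function of two variables with degenerate Hessian, the null direction of the Hessian
is constant along the line in that direction, and the reciprocal of the second derivative across
this line is an affine function. The function enters through its two partial derivatives. -/
theorem hessian_along_kernel {A B : ℝ × ℝ → ℝ} (hA : ContDiffAt ℝ 1 A 0)
    (hB : ContDiffAt ℝ 1 B 0)
    (hsymm : ∀ᶠ z in 𝓝 (0 : ℝ × ℝ), fderiv ℝ A z (0, 1) = fderiv ℝ B z (1, 0))
    (hdet : ∀ᶠ z in 𝓝 (0 : ℝ × ℝ), fderiv ℝ A z (1, 0) * fderiv ℝ B z (0, 1) =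
      fderiv ℝ A z (0, 1) * fderiv ℝ B z (1, 0))
    (h1 : fderiv ℝ A 0 (1, 0) ≠ 0) (h2 : fderiv ℝ A 0 (0, 1) = 0) :
    ∃ δ > 0, ∃ K : ℝ, ∀ s : ℝ, |s| < δ → fderiv ℝ A (0, s) (0, 1) = 0 ∧
      fderiv ℝ A (0, s) (1, 0) * ((fderiv ℝ A 0 (1, 0))⁻¹ + K * s) = 1 := by
  obtain ⟨X, hX, hX0, hXeq⟩ := exists_implicit_solution hA h1
  set a := A 0
  let Y : ℝ × ℝ → ℝ × ℝ := fun z => (X z, z.2)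
  have hY0 : Y (a, 0) = 0 := by simp [Y, hX0]
  have hYc : Tendsto Y (𝓝 (a, 0)) (𝓝 0) := by
    have : ContinuousAt Y (a, 0) := hX.continuousAt.prodMk continuousAt_snd
    simpa [ContinuousAt, hY0] using this
  have hAc : ∀ᶠ z in 𝓝 (0 : ℝ × ℝ), fderiv ℝ A z (1, 0) ≠ 0 := by
    have : ContinuousAt (fun z => fderiv ℝ A z (1, 0)) 0 :=
      (hA.fderiv_right (m := 0) (by norm_num)).continuousAt.clm_apply continuousAt_const
    exact this.eventually_ne h1
  -- With `u` the value of `A`, implicit differentiation gives `A_x X_u = 1` and `A_x X_η + A_y =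
  -- 0`. The degenerate determinant then makes `B ∘ Y` a function of `u` alone, with derivative
  -- `-X_η`.
  have key : ∀ᶠ z in 𝓝 (a, (0 : ℝ)), DifferentiableAt ℝ X z ∧
      fderiv ℝ A (Y z) (1, 0) * fderiv ℝ X z (1, 0) = 1 ∧
      fderiv ℝ A (Y z) (1, 0) * fderiv ℝ X z (0, 1) + fderiv ℝ A (Y z) (0, 1) = 0 ∧
      ∃ C' : ℝ × ℝ →L[ℝ] ℝ, HasFDerivAt (fun z => B (Y z)) C' z ∧ C' (0, 1) = 0 ∧
        C' (1, 0) = -fderiv ℝ X z (0, 1) := by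
    filter_upwards [hX.eventually (by norm_num), hXeq.eventually_nhds,
      hYc.eventually (hA.eventually (by norm_num)), hYc.eventually (hB.eventually (by norm_num)),
      hYc.eventually hsymm, hYc.eventually hdet, hYc.eventually hAc] with z h3 h4 h5 h6 h7 h8 h9
    have dX := (h3.differentiableAt one_ne_zero)
    have dY : HasFDerivAt Y ((fderiv ℝ X z).prod (ContinuousLinearMap.snd ℝ ℝ ℝ)) z :=
      dX.hasFDerivAt.prodMk hasFDerivAt_snd
    have dA := (h5.differentiableAt one_ne_zero).hasFDerivAt.comp z dY
    have dB := (h6.differentiableAt one_ne_zero).hasFDerivAt.comp z dY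
    have eA := dA.unique (hasFDerivAt_fst.congr_of_eventuallyEq h4)
    have split : ∀ (T : ℝ × ℝ →L[ℝ] ℝ) (p q : ℝ), T (p, q) = T (1, 0) * p + T (0, 1) * q := by
      intro T p q
      have : ((p, q) : ℝ × ℝ) = p • (1, 0) + q • (0, 1) := by simp
      rw [this, map_add, map_smul, map_smul, smul_eq_mul, smul_eq_mul]
      ring
    have e1 := congrArg (fun T => T (1, 0)) eA
    have e2 := congrArg (fun T => T (0, 1)) eA
    simp only [ContinuousLinearMap.comp_apply, ContinuousLinearMap.prod_apply,
      ContinuousLinearMap.coe_snd', ContinuousLinearMap.coe_fst'] at e1 e2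
    rw [split] at e1 e2
    refine ⟨dX, by linarith, by linarith, _, dB, ?_, ?_⟩
    · simp only [ContinuousLinearMap.comp_apply, ContinuousLinearMap.prod_apply,
        ContinuousLinearMap.coe_snd']
      rw [split, ← h7]
      refine (mul_eq_zero.1 (?_ : fderiv ℝ A (Y z) (1, 0) * _ = 0)).resolve_left h9
      rw [← h7] at h8
      linear_combination fderiv ℝ A (Y z) (0, 1) * e2 + h8
    · simp only [ContinuousLinearMap.comp_apply, ContinuousLinearMap.prod_apply,
        ContinuousLinearMap.coe_snd']
      rw [split, ← h7]
      refine mul_left_cancel₀ h9 ?_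
      linear_combination fderiv ℝ A (Y z) (0, 1) * e1 + e2
  obtain ⟨ε, hε, hkey⟩ := Metric.eventually_nhds_iff.1 key
  have hkey' : ∀ u η : ℝ, |u - a| < ε → |η| < ε → _ := fun u η hu hη =>
    @hkey (u, η) (by rw [Prod.dist_eq]; simpa [Real.dist_eq] using ⟨hu, hη⟩)
  have hz : |(0 : ℝ)| < ε := by simpa using hε
  have ha : |a - a| < ε := by simpa using hε
  have hnear : ∀ {u : ℝ}, |u - a| < ε → ∀ᶠ u' in 𝓝 u, |u' - a| < ε := fun {u} hu =>
    (continuous_abs.comp (continuous_id.sub continuous_const)).continuousAt.eventually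
      (eventually_lt_nhds hu)
  have c1 : ∀ u η : ℝ, |u - a| < ε → |η| < ε → B (Y (u, η)) = B (Y (u, 0)) := by
    intro u η hu hη
    refine eq_of_hasDerivAt_zero (f := fun η => B (Y (u, η))) (ε := ε) (fun s hs => ?_) hη hz
    obtain ⟨-, -, -, C', hC, hC0, -⟩ := hkey' u s hu hs
    simpa [hC0] using hasDerivAt_slice_snd hC
  -- By `c1` the slices of `B ∘ Y` at heights `η` and `0` coincide, hence so do their derivatives in
  -- `u`, which are `-X_η`.
  have c2 : ∀ u η : ℝ, |u - a| < ε → |η| < ε →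
      fderiv ℝ X (u, η) (0, 1) = fderiv ℝ X (u, 0) (0, 1) := by
    intro u η hu hη
    obtain ⟨-, -, -, C', hC, -, hC1⟩ := hkey' u η hu hη
    obtain ⟨-, -, -, C'', hD, -, hD1⟩ := hkey' u 0 hu hz
    have e := (hasDerivAt_slice_fst hC).unique ((hasDerivAt_slice_fst hD).congr_of_eventuallyEq
      ((hnear hu).mono fun u' hu' => c1 u' η hu' hη))
    rw [hC1, hD1] at e
    exact neg_injective e
  have c3 : ∀ u η : ℝ, |u - a| < ε → |η| < ε →
      X (u, η) = X (u, 0) + fderiv ℝ X (u, 0) (0, 1) * η := by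
    intro u η hu hη
    have := eq_of_hasDerivAt_zero (f := fun η => X (u, η) - fderiv ℝ X (u, 0) (0, 1) * η)
      (ε := ε) (fun s hs => ?_) hη hz
    · linarith
    · have h := (hasDerivAt_slice_snd (hkey' u s hu hs).1.hasFDerivAt).sub
        ((hasDerivAt_id s).const_mul (fderiv ℝ X (u, 0) (0, 1)))
      rw [c2 u s hu hs] at h
      exact h.congr_deriv (by simp)
  have c4 : fderiv ℝ X (a, 0) (0, 1) = 0 := by
    have := (hkey' a 0 ha hz).2.2.1
    rw [hY0, h2, add_zero] at this
    exact (mul_eq_zero.1 this).resolve_left h1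
  have c5 : ∀ η : ℝ, |η| < ε → Y (a, η) = (0, η) := by
    intro η hη
    simp [Y, c3 a η ha hη, c4, hX0]
  have c6 : (fderiv ℝ A 0 (1, 0))⁻¹ = fderiv ℝ X (a, 0) (1, 0) := by
    have := (hkey' a 0 ha hz).2.1
    rw [hY0] at this
    exact inv_eq_of_mul_eq_one_right this
  have hη₁ : |ε / 2| < ε := by rw [abs_of_pos (by linarith)]; linarith
  refine ⟨ε, hε, (fderiv ℝ X (a, ε / 2) (1, 0) - fderiv ℝ X (a, 0) (1, 0)) / (ε / 2),
    fun s hs => ?_⟩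
  obtain ⟨dX, e1, e2, -⟩ := hkey' a s ha hs
  rw [c5 s hs] at e1 e2
  rw [c2 a s ha hs, c4, mul_zero, zero_add] at e2
  refine ⟨e2, ?_⟩
  have d := hasDerivAt_slice_fst dX.hasFDerivAt
  have d0 := hasDerivAt_slice_fst (hkey' a 0 ha hz).1.hasFDerivAt
  have d1 := hasDerivAt_slice_fst (hkey' a (ε / 2) ha hη₁).1.hasFDerivAt
  -- As `X` is affine in `η`, the slice at `s` is a fixed combination of the slices at `0` and `ε /
  -- 2`. Its `u`-derivative is thus affine in `s`, without any second derivative of `X`.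
  have d' := d0.add ((d1.sub d0).const_mul (s / (ε / 2)))
  have := d.unique (d'.congr_of_eventuallyEq ((hnear ha).mono fun u hu => by
    simp only [Pi.add_apply, Pi.sub_apply]
    rw [c3 u s hu hs, c3 u (ε / 2) hu hη₁]
    field_simp
    ring))
  rw [this] at e1
  rw [c6]
  linear_combination e1

end RuledImmersion

/-! ### Kernel lines in the region, limits at the boundary, and rulings with a common endpoint. -/

namespace RuledImmersion

variable {D : Set Plane} {χ : Plane → Space}

theorem IsIsometricImmersion.inner_hess_det (hχ : IsIsometricImmersion D χ) (hD : IsOpen D)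
    {x : Plane} (hx : x ∈ D) (a : Space) (v w : Plane) :
    inner ℝ a (fderiv ℝ (fderiv ℝ χ) x w w) * inner ℝ a (fderiv ℝ (fderiv ℝ χ) x v v) =
      inner ℝ a (fderiv ℝ (fderiv ℝ χ) x v w) * inner ℝ a (fderiv ℝ (fderiv ℝ χ) x w v) := by
  by_cases hw : fderiv ℝ (fderiv ℝ χ) x w w = 0
  · have h := hχ.hess_eq_zero_of_diag hD hx hw
    simp [h]
  · obtain ⟨r, hr⟩ := hχ.hess_collinear hD hx hw v w
    obtain ⟨r', hr'⟩ := hχ.hess_collinear hD hx hw v v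
    have hg := hχ.gauss hD hx v v w w
    rw [hχ.hess_symm hD hx w v, ← hr, ← hr', inner_smul_left, inner_smul_left,
      inner_smul_right] at hg
    have h0 : inner ℝ (fderiv ℝ (fderiv ℝ χ) x w w) (fderiv ℝ (fderiv ℝ χ) x w w) ≠ (0 : ℝ) := by
      simpa using hw
    have h1 : r' = r * r := by
      refine mul_right_cancel₀ h0 ?_
      simpa [mul_assoc] using hg
    rw [hχ.hess_symm hD hx w v, ← hr, ← hr', h1, inner_smul_right, inner_smul_right]
    ring

/-- The component of `χ` along a fixed vector `a` is a scalar function with degenerate Hessian, so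
`hessian_along_kernel` applies in the coordinates spanned by `rot v` and `v`. -/
theorem IsIsometricImmersion.hess_kernel_local (hχ : IsIsometricImmersion D χ) (hD : IsOpen D)
    {x v : Plane} {a : Space} (hx : x ∈ D) (h0 : fderiv ℝ (fderiv ℝ χ) x v = 0)
    (ha : inner ℝ a (fderiv ℝ (fderiv ℝ χ) x (rot v) (rot v)) ≠ 0) :
    ∃ δ > 0, ∃ K : ℝ, ∀ s : ℝ, |s| < δ → x + s • v ∈ D ∧
      fderiv ℝ (fderiv ℝ χ) (x + s • v) v = 0 ∧
      inner ℝ a (fderiv ℝ (fderiv ℝ χ) (x + s • v) (rot v) (rot v)) *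
        ((inner ℝ a (fderiv ℝ (fderiv ℝ χ) x (rot v) (rot v)))⁻¹ + K * s) = 1 := by
  set w := rot v
  let T : ℝ × ℝ →L[ℝ] Plane := (ContinuousLinearMap.fst ℝ ℝ ℝ).smulRight w +
    (ContinuousLinearMap.snd ℝ ℝ ℝ).smulRight v
  let P : ℝ × ℝ → Plane := fun z => x + T z
  have hT : ∀ p q : ℝ, T (p, q) = p • w + q • v := fun p q => rfl
  have hP : ContDiff ℝ 1 P := contDiff_const.add T.contDiff
  have hP' : ∀ z, HasFDerivAt P T z := fun z => T.hasFDerivAt.const_add x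
  have hP0 : P 0 = x := by simp [P]
  have hPs : ∀ s : ℝ, P (0, s) = x + s • v := fun s => by simp [P, hT]
  have hmem : ∀ᶠ z in 𝓝 (0 : ℝ × ℝ), P z ∈ D :=
    hP.continuous.continuousAt.eventually (hD.mem_nhds (by rwa [hP0]))
  let F : Plane → ℝ × ℝ → ℝ := fun u z => inner ℝ a (fderiv ℝ χ (P z) u)
  have hFc : ∀ u, ContDiffAt ℝ 1 (F u) 0 := fun u => by
    have h1 : ContDiffAt ℝ 1 (fun z => fderiv ℝ χ (P z)) 0 :=
      ContDiffAt.comp (0 : ℝ × ℝ) (g := fderiv ℝ χ)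
        (hχ.contDiffAt_fderiv hD (by rwa [hP0])) hP.contDiffAt
    exact contDiffAt_const.inner ℝ (h1.clm_apply contDiffAt_const)
  have hF : ∀ u z, P z ∈ D → ∀ h,
      fderiv ℝ (F u) z h = inner ℝ a (fderiv ℝ (fderiv ℝ χ) (P z) (T h) u) := by
    intro u z hz h
    have h1 : HasFDerivAt (fun z => fderiv ℝ χ (P z)) _ z :=
      (hχ.hasFDerivAt_fderiv hD hz).comp z (hP' z)
    have h2 := ((innerSL ℝ a).comp (ContinuousLinearMap.apply ℝ Space u)).hasFDerivAt.comp z h1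
    exact congrArg (fun L : ℝ × ℝ →L[ℝ] ℝ => L h) h2.fderiv
  have e1 : T (1, 0) = w := by simp [hT]
  have e2 : T (0, 1) = v := by simp [hT]
  have hz0 : P 0 ∈ D := by rwa [hP0]
  obtain ⟨δ, hδ, K, hK⟩ := hessian_along_kernel (hFc w) (hFc v)
    (hmem.mono fun z hz => by
      rw [hF w z hz, hF v z hz, e1, e2, hχ.hess_symm hD hz])
    (hmem.mono fun z hz => by
      rw [hF w z hz, hF v z hz, hF w z hz, hF v z hz, e1, e2, hχ.inner_hess_det hD hz])
    (by rwa [hF w 0 hz0, e1, hP0]) (by rw [hF w 0 hz0, e2, hP0, h0]; simp)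
  obtain ⟨ε, hε, hε'⟩ := Metric.eventually_nhds_iff.1 hmem
  refine ⟨min δ ε, lt_min hδ hε, K, fun s hs => ?_⟩
  have hs1 := hs.trans_le (min_le_left _ _)
  have hs2 : P (0, s) ∈ D := hε' (by
    simpa [Prod.dist_eq] using hs.trans_le (min_le_right _ _))
  obtain ⟨k1, k2⟩ := hK s hs1
  rw [hF w _ hs2, e2] at k1
  rw [hF w _ hs2, hF w _ hz0, e1, hP0] at k2
  rw [hPs] at k1 k2 hs2
  exact ⟨hs2, hχ.hess_eq_zero_of_inner hD hs2 (left_ne_zero_of_mul_eq_one k2) k1, k2⟩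

theorem continuous_line (x v : Plane) : Continuous fun s : ℝ => x + s • v := by fun_prop

/-- Along a segment in `D` in the kernel direction `v` of the second derivative of `χ`, the
reciprocal of the second derivative across the segment is affine. -/
theorem IsIsometricImmersion.hess_kernel_segment (hχ : IsIsometricImmersion D χ) (hD : IsOpen D)
    {x v : Plane} {a : Space} (hx : x ∈ D) (h0 : fderiv ℝ (fderiv ℝ χ) x v = 0)
    (ha : inner ℝ a (fderiv ℝ (fderiv ℝ χ) x (rot v) (rot v)) ≠ 0) :
    ∃ K : ℝ, ∀ S : ℝ, 0 ≤ S → (∀ s ∈ Icc 0 S, x + s • v ∈ D) → ∀ s ∈ Icc 0 S,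
      fderiv ℝ (fderiv ℝ χ) (x + s • v) v = 0 ∧
      inner ℝ a (fderiv ℝ (fderiv ℝ χ) (x + s • v) (rot v) (rot v)) *
        ((inner ℝ a (fderiv ℝ (fderiv ℝ χ) x (rot v) (rot v)))⁻¹ + K * s) = 1 := by
  obtain ⟨δ, hδ, K, hK⟩ := hχ.hess_kernel_local hD hx h0 ha
  refine ⟨K, fun S hS hseg => ?_⟩
  set b₀ := (inner ℝ a (fderiv ℝ (fderiv ℝ χ) x (rot v) (rot v)))⁻¹
  let β : ℝ → ℝ := fun s => inner ℝ a (fderiv ℝ (fderiv ℝ χ) (x + s • v) (rot v) (rot v))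
  let u : Set ℝ := {t | ∀ᶠ s in 𝓝 t, fderiv ℝ (fderiv ℝ χ) (x + s • v) v = 0 ∧
    β s * (b₀ + K * s) = 1}
  have hu : IsOpen u := isOpen_setOfPred_eventually_nhds
  have h0u : (0 : ℝ) ∈ u := by
    refine Metric.eventually_nhds_iff.2 ⟨δ, hδ, fun s hs => ?_⟩
    rw [Real.dist_eq, sub_zero] at hs
    exact (hK s hs).2
  -- Continuation along the segment: `u` is open, and at a limit point both relations persist by
  -- continuity, so the local lemma can be restarted there.
  have hsub : Icc 0 S ⊆ u := by
    refine isPreconnected_Icc.subset_of_closure_inter_subset hu ⟨0, ⟨le_rfl, hS⟩, h0u⟩ ?_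
    rintro t ⟨htu, htS⟩
    have htD := hseg t htS
    have hHc : ContinuousAt (fun s : ℝ => fderiv ℝ (fderiv ℝ χ) (x + s • v)) t :=
      ContinuousAt.comp (f := fun s : ℝ => x + s • v) (g := fderiv ℝ (fderiv ℝ χ))
        (hχ.continuousAt_hess hD htD) (continuous_line x v).continuousAt
    have hfr : ∃ᶠ s in 𝓝 t, fderiv ℝ (fderiv ℝ χ) (x + s • v) v = 0 ∧ β s * (b₀ + K * s) = 1 :=
      (mem_closure_iff_frequently.1 htu).mono fun s hs => hs.self_of_nhds
    have t1 : fderiv ℝ (fderiv ℝ χ) (x + t • v) v = 0 := by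
      by_contra hne
      exact (hfr.and_eventually ((hHc.clm_apply continuousAt_const).eventually_ne hne)).exists.elim
        fun s hs => hs.2 hs.1.1
    have hβ : ContinuousAt β t :=
      continuousAt_const.inner ((hHc.clm_apply continuousAt_const).clm_apply continuousAt_const)
    have t2 : β t * (b₀ + K * t) = 1 := by
      by_contra hne
      have hc : ContinuousAt (fun s => β s * (b₀ + K * s)) t :=
        hβ.mul (by fun_prop)
      exact (hfr.and_eventually (hc.eventually_ne hne)).exists.elim fun s hs => hs.2 hs.1.2
    obtain ⟨δ', hδ', K', hK'⟩ := hχ.hess_kernel_local hD htD t1 (left_ne_zero_of_mul_eq_one t2)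
    have hloc : ∀ s, |s - t| < δ' → fderiv ℝ (fderiv ℝ χ) (x + s • v) v = 0 ∧
        β s * ((β t)⁻¹ + K' * (s - t)) = 1 := by
      intro s hs
      have := (hK' (s - t) hs).2
      rw [add_assoc, ← add_smul, add_sub_cancel] at this
      exact this
    obtain ⟨t₁, ht₁, ht₁u⟩ := mem_closure_iff.1 htu (Metric.ball t δ') Metric.isOpen_ball
      (Metric.mem_ball_self hδ')
    -- Both affine functions are the reciprocal of `β` near `t₁`, so their slopes and constants
    -- agree and the old formula extends past `t`.
    have hev : (fun s => b₀ + K * s) =ᶠ[𝓝 t₁] fun s => (β t)⁻¹ + K' * (s - t) := by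
      filter_upwards [ht₁u, Metric.isOpen_ball.mem_nhds ht₁] with s hs hs'
      have h := (hloc s (by simpa [Real.dist_eq] using hs')).2
      exact mul_left_cancel₀ (left_ne_zero_of_mul_eq_one h) (hs.2.trans h.symm)
    have d1 : HasDerivAt (fun s => b₀ + K * s) (K * 1) t₁ :=
      ((hasDerivAt_id t₁).const_mul K).const_add b₀
    have d2 : HasDerivAt (fun s => (β t)⁻¹ + K' * (s - t)) (K' * 1) t₁ :=
      (((hasDerivAt_id t₁).sub_const t).const_mul K').const_add _
    have hKK : K = K' := by simpa using d1.unique (d2.congr_of_eventuallyEq hev)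
    have hc := hev.self_of_nhds
    simp only [hKK] at hc
    refine Metric.eventually_nhds_iff.2 ⟨δ', hδ', fun s hs => ?_⟩
    rw [Real.dist_eq] at hs
    obtain ⟨l1, l2⟩ := hloc s hs
    refine ⟨l1, ?_⟩
    rw [← l2, hKK]
    congr 1
    linarith
  exact fun s hs => (hsub hs).self_of_nhds

theorem IsIsometricImmersion.inner_hess_rot_ne_zero (hχ : IsIsometricImmersion D χ)
    (hD : IsOpen D) {x v : Plane} (hx : x ∈ D) (hv : v ≠ 0)
    (h0 : fderiv ℝ (fderiv ℝ χ) x v = 0) (hne : fderiv ℝ (fderiv ℝ χ) x ≠ 0) :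
    inner ℝ (fderiv ℝ (fderiv ℝ χ) x (rot v) (rot v))
      (fderiv ℝ (fderiv ℝ χ) x (rot v) (rot v)) ≠ (0 : ℝ) := fun h =>
  hne (hess_eq_zero_of_rot (hχ.hess_symm hD hx) hv h0 (by simpa using h))

/-- Taking `a` to be the second derivative across the line at `x`, the product identity excludes a
zero further on; the gradient is constant because its derivative along the line is the kernel value.
-/
theorem IsIsometricImmersion.ruling_line (hχ : IsIsometricImmersion D χ) (hD : IsOpen D)
    {x v : Plane} (hv : v ≠ 0) (h0 : fderiv ℝ (fderiv ℝ χ) x v = 0)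
    (hne : fderiv ℝ (fderiv ℝ χ) x ≠ 0) {S : ℝ} (hS : 0 ≤ S)
    (hseg : ∀ s ∈ Icc 0 S, x + s • v ∈ D) {s : ℝ} (hs : s ∈ Icc 0 S) :
    fderiv ℝ (fderiv ℝ χ) (x + s • v) v = 0 ∧ fderiv ℝ (fderiv ℝ χ) (x + s • v) ≠ 0 ∧
      fderiv ℝ χ (x + s • v) = fderiv ℝ χ x := by
  have hx : x ∈ D := by simpa using hseg 0 ⟨le_rfl, hS⟩
  obtain ⟨K, hK⟩ := hχ.hess_kernel_segment hD hx h0 (hχ.inner_hess_rot_ne_zero hD hx hv h0 hne)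
  have hK' := hK S hS hseg
  have hd : ∀ s ∈ Icc 0 S, HasDerivAt (fun s : ℝ => fderiv ℝ χ (x + s • v)) 0 s := by
    intro s hs
    have h1 : HasDerivAt (fun s : ℝ => x + s • v) ((1 : ℝ) • v) s :=
      ((hasDerivAt_id s).smul_const v).const_add x
    have := (hχ.hasFDerivAt_fderiv hD (hseg s hs)).comp_hasDerivAt s h1
    rwa [one_smul, (hK' s hs).1] at this
  refine ⟨(hK' s hs).1, fun h => ?_, ?_⟩
  · have := (hK' s hs).2
    rw [h] at this
    simp at this
  · have := constant_of_has_deriv_right_zero (fun s hs => (hd s hs).continuousAt.continuousWithinAt)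
      (fun s hs => (hd s ⟨hs.1, hs.2.le⟩).hasDerivWithinAt) s hs
    simpa using this

/-- The limits at a point of the closure of `D` of the first two derivatives of `χ`. -/
theorem IsIsometricImmersion.exists_boundary_jet (hχ : IsIsometricImmersion D χ) (hD : IsOpen D)
    {p : Plane} (hp : p ∈ closure D) :
    ∃ (Gp : Plane →L[ℝ] Space) (Hp : Plane →L[ℝ] Plane →L[ℝ] Space) (C : ℝ),
      Tendsto (fderiv ℝ χ) (𝓝[D] p) (𝓝 Gp) ∧
      Tendsto (fderiv ℝ (fderiv ℝ χ)) (𝓝[D] p) (𝓝 Hp) ∧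
      HasFDerivWithinAt χ Gp (closure D) p ∧
      ∀ᶠ x in 𝓝[D] p, ‖fderiv ℝ χ x - Gp‖ ≤ C * ‖x - p‖ := by
  have h2 : ContDiffWithinAt ℝ (1 + 1) χ (closure D) p := by
    simpa [one_add_one_eq_two] using hχ.contDiffOn p hp
  obtain ⟨u, hu, -, -, f', hf', hf'c⟩ :=
    (contDiffWithinAt_succ_iff_hasFDerivWithinAt' (by simp)).1 h2
  have h1 : ContDiffWithinAt ℝ (0 + 1) f' (closure D) p := by simpa using hf'c
  obtain ⟨u', hu', -, -, f'', hf'', hf''c⟩ :=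
    (contDiffWithinAt_succ_iff_hasFDerivWithinAt' (by simp)).1 h1
  rw [insert_eq_of_mem hp] at hu hu'
  obtain ⟨W, hW, hpW, hWu⟩ := mem_nhdsWithin.1 (inter_mem hu hu')
  -- Differentiability within the closure is ordinary differentiability at points of the open set
  -- `D`.
  have e1 : ∀ x ∈ W ∩ D, fderiv ℝ χ x = f' x := fun x hx =>
    ((hf' x (hWu ⟨hx.1, subset_closure hx.2⟩).1).hasFDerivAt
      (mem_of_superset (hD.mem_nhds hx.2) subset_closure)).fderiv
  have e2 : ∀ x ∈ W ∩ D, fderiv ℝ (fderiv ℝ χ) x = f'' x := fun x hx => by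
    have h := (hf'' x (hWu ⟨hx.1, subset_closure hx.2⟩).2).hasFDerivAt
      (mem_of_superset (hD.mem_nhds hx.2) subset_closure)
    refine (h.congr_of_eventuallyEq ?_).fderiv
    filter_upwards [(hW.inter hD).mem_nhds hx] with y hy using e1 y hy
  have hWD : W ∩ D ∈ 𝓝[D] p := inter_mem (mem_nhdsWithin_of_mem_nhds (hW.mem_nhds hpW))
    self_mem_nhdsWithin
  have hle : 𝓝[D] p ≤ 𝓝[closure D] p := nhdsWithin_mono _ subset_closure
  have hpc : p ∈ W ∩ closure D := ⟨hpW, hp⟩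
  have hO := (hf'' p (hWu hpc).2).isBigO_sub
  obtain ⟨C, hC⟩ := hO.bound
  refine ⟨f' p, f'' p, C, ?_, ?_, hf' p (hWu hpc).1, ?_⟩
  · refine (hf'c.continuousWithinAt.tendsto.mono_left hle).congr' ?_
    filter_upwards [hWD] with x hx using (e1 x hx).symm
  · refine (hf''c.continuousWithinAt.tendsto.mono_left hle).congr' ?_
    filter_upwards [hWD] with x hx using (e2 x hx).symm
  · filter_upwards [hWD, hC.filter_mono hle] with x hx hx'
    rwa [e1 x hx]

theorem tendsto_clm_apply {ι F : Type*} [NormedAddCommGroup F] [NormedSpace ℝ F] {l : Filter ι}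
    {f : ι → Plane →L[ℝ] F} {L : Plane →L[ℝ] F} (h : Tendsto f l (𝓝 L)) (v : Plane) :
    Tendsto (fun x => f x v) l (𝓝 (L v)) :=
  ((ContinuousLinearMap.apply ℝ F v).continuous.tendsto L).comp h

theorem norm_map_of_tendsto (hχ : IsIsometricImmersion D χ) {p : Plane}
    (hp : p ∈ closure D) {Gp : Plane →L[ℝ] Space}
    (h : Tendsto (fderiv ℝ χ) (𝓝[D] p) (𝓝 Gp)) (v : Plane) : ‖Gp v‖ = ‖v‖ := by
  have := mem_closure_iff_nhdsWithin_neBot.1 hp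
  have h1 : Tendsto (fun x => ‖fderiv ℝ χ x v‖) (𝓝[D] p) (𝓝 ‖Gp v‖) :=
    (tendsto_clm_apply h v).norm
  refine tendsto_nhds_unique h1 (tendsto_const_nhds.congr' ?_)
  filter_upwards [self_mem_nhdsWithin] with x hx using (hχ.isometric x hx v).symm

theorem IsRuling.symm {p q : Plane} (h : IsRuling D χ p q) : IsRuling D χ q p where
  ne := h.ne.symm
  left_mem := h.right_mem
  right_mem := h.left_mem
  interior_subset := by rw [openSegment_symm]; exact h.interior_subset
  curved := by rw [openSegment_symm]; exact h.curved
  straight s hs := by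
    have := h.straight (1 - s) ⟨by linarith [hs.2], by linarith [hs.1]⟩
    rwa [AffineMap.lineMap_apply_one_sub, AffineMap.lineMap_apply_one_sub] at this

theorem add_smul_mem_openSegment {p q : Plane} {s : ℝ} (h0 : 0 < s) (h1 : s < 1) :
    p + s • (q - p) ∈ openSegment ℝ p q :=
  ⟨1 - s, s, by linarith, h0, by ring, by module⟩

theorem IsRuling.mem {p q : Plane} (h : IsRuling D χ p q) {s : ℝ} (h0 : 0 < s) (h1 : s < 1) :
    p + s • (q - p) ∈ D := h.interior_subset (add_smul_mem_openSegment h0 h1)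

theorem IsRuling.hess_ne {p q : Plane} (h : IsRuling D χ p q) {s : ℝ} (h0 : 0 < s) (h1 : s < 1) :
    fderiv ℝ (fderiv ℝ χ) (p + s • (q - p)) ≠ 0 := h.curved _ (add_smul_mem_openSegment h0 h1)

/-- Straightness makes the gradient in the ruling direction constant along the ruling, so the
diagonal entry vanishes; for a rank-one form this already gives the kernel. -/
theorem IsRuling.hess_dir (hχ : IsIsometricImmersion D χ) (hD : IsOpen D) {p q : Plane}
    (h : IsRuling D χ p q) {s : ℝ} (h0 : 0 < s) (h1 : s < 1) :
    fderiv ℝ (fderiv ℝ χ) (p + s • (q - p)) (q - p) = 0 := by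
  have hl : ∀ s : ℝ, HasDerivAt (fun s : ℝ => p + s • (q - p)) (q - p) s := fun s => by
    simpa using ((hasDerivAt_id s).smul_const (q - p)).const_add p
  have e1 : ∀ s ∈ Ioo (0 : ℝ) 1, fderiv ℝ χ (p + s • (q - p)) (q - p) = χ q - χ p := by
    intro s hs
    have d1 := (hχ.hasFDerivAt hD (h.mem hs.1 hs.2)).comp_hasDerivAt s (hl s)
    have d2 : HasDerivAt (fun s : ℝ => χ p + s • (χ q - χ p)) (χ q - χ p) s := by
      simpa using ((hasDerivAt_id s).smul_const (χ q - χ p)).const_add (χ p)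
    refine d1.unique (d2.congr_of_eventuallyEq ?_)
    filter_upwards [Icc_mem_nhds hs.1 hs.2] with t ht
    have := h.straight t ht
    rw [AffineMap.lineMap_apply_module', AffineMap.lineMap_apply_module', add_comm,
      add_comm _ (χ p)] at this
    exact this
  refine hχ.hess_eq_zero_of_diag hD (h.mem h0 h1) ?_
  have d1 := (hχ.hasFDerivAt_fderiv hD (h.mem h0 h1)).comp_hasDerivAt s (hl s)
  have d2 : HasDerivAt (fun s : ℝ => fderiv ℝ χ (p + s • (q - p)) (q - p))
      (fderiv ℝ (fderiv ℝ χ) (p + s • (q - p)) (q - p) (q - p)) s := by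
    simpa using d1.clm_apply (hasDerivAt_const s (q - p))
  refine d2.unique ((hasDerivAt_const s (χ q - χ p)).congr_of_eventuallyEq ?_)
  filter_upwards [Ioo_mem_nhds h0 h1] with t ht using e1 t ht

theorem IsRuling.tendsto {p q : Plane} (h : IsRuling D χ p q) :
    Tendsto (fun s : ℝ => p + s • (q - p)) (𝓝[>] 0) (𝓝[D] p) := by
  refine tendsto_nhdsWithin_iff.2 ⟨?_, ?_⟩
  · have := (continuous_line p (q - p)).tendsto 0
    rw [zero_smul, add_zero] at this
    exact this.mono_left nhdsWithin_le_nhds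
  · filter_upwards [Ioo_mem_nhdsGT (zero_lt_one' ℝ)] with s hs using h.mem hs.1 hs.2

/-- The second derivative across the ruling has an affine reciprocal starting from the midpoint. If
the limit form were zero, the product `1` would tend to zero times a finite number. -/
theorem IsRuling.boundary_hess (hχ : IsIsometricImmersion D χ) (hD : IsOpen D) {p q : Plane}
    (h : IsRuling D χ p q) {Hp : Plane →L[ℝ] Plane →L[ℝ] Space}
    (hHp : Tendsto (fderiv ℝ (fderiv ℝ χ)) (𝓝[D] p) (𝓝 Hp)) : Hp (q - p) = 0 ∧ Hp ≠ 0 := by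
  have hH := hHp.comp h.tendsto
  constructor
  · refine tendsto_nhds_unique (tendsto_clm_apply hH (q - p))
      (tendsto_const_nhds.congr' ?_)
    filter_upwards [Ioo_mem_nhdsGT (zero_lt_one' ℝ)] with s hs
      using (h.hess_dir hχ hD hs.1 hs.2).symm
  · rintro rfl
    have hv : p - q ≠ 0 := sub_ne_zero.2 h.ne
    have e : ∀ s : ℝ, p + (1 / 2 : ℝ) • (q - p) + s • (p - q) = p + (1 / 2 - s) • (q - p) :=
      fun s => by module
    have hm : p + (1 / 2 : ℝ) • (q - p) ∈ D := h.mem (by norm_num) (by norm_num)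
    have hk : fderiv ℝ (fderiv ℝ χ) (p + (1 / 2 : ℝ) • (q - p)) (p - q) = 0 := by
      rw [← neg_sub q p, map_neg, h.hess_dir hχ hD (by norm_num) (by norm_num), neg_zero]
    have hne := hχ.inner_hess_rot_ne_zero hD hm hv hk (h.hess_ne (by norm_num) (by norm_num))
    obtain ⟨K, hK⟩ := hχ.hess_kernel_segment hD hm hk hne
    generalize fderiv ℝ (fderiv ℝ χ) (p + (1 / 2 : ℝ) • (q - p)) (rot (p - q)) (rot (p - q)) = a
      at *
    have hlim : Tendsto (fun s : ℝ => inner ℝ a (fderiv ℝ (fderiv ℝ χ) (p + s • (q - p))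
        (rot (p - q)) (rot (p - q))) * ((inner ℝ a a)⁻¹ + K * (1 / 2 - s))) (𝓝[>] 0)
        (𝓝 (0 * ((inner ℝ a a)⁻¹ + K * (1 / 2 - 0)))) := by
      refine Tendsto.mul ?_ ?_
      · have := (tendsto_const_nhds (x := a)).inner (tendsto_clm_apply
          (tendsto_clm_apply hH (rot (p - q))) (rot (p - q))) (𝕜 := ℝ)
        simpa using this
      · exact ((Continuous.tendsto (by fun_prop) 0).mono_left nhdsWithin_le_nhds)
    have : Tendsto (fun _ : ℝ => (1 : ℝ)) (𝓝[>] 0) (𝓝 0) := by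
      rw [zero_mul] at hlim
      refine hlim.congr' ?_
      filter_upwards [Ioo_mem_nhdsGT (show (0 : ℝ) < 1 / 2 by norm_num)] with s hs
      have := (hK (1 / 2 - s) (by linarith [hs.2]) (fun t ht => by
        rw [e]; exact h.mem (by linarith [ht.2, hs.1]) (by linarith [ht.1])) (1 / 2 - s)
        ⟨by linarith [hs.2], le_rfl⟩).2
      rwa [e, sub_sub_cancel] at this
    exact one_ne_zero (tendsto_nhds_unique tendsto_const_nhds this)

theorem IsRuling.fderiv_eq_boundary (hχ : IsIsometricImmersion D χ) (hD : IsOpen D) {p q : Plane}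
    (h : IsRuling D χ p q) {Gp : Plane →L[ℝ] Space}
    (hGp : Tendsto (fderiv ℝ χ) (𝓝[D] p) (𝓝 Gp)) {s : ℝ} (h0 : 0 < s) (h1 : s < 1) :
    fderiv ℝ χ (p + s • (q - p)) = Gp := by
  refine tendsto_nhds_unique (tendsto_const_nhds.congr' ?_) (hGp.comp h.tendsto)
  filter_upwards [Ioo_mem_nhdsGT h0] with t ht
  have e : ∀ r : ℝ, p + t • (q - p) + r • (q - p) = p + (t + r) • (q - p) := fun r => by module
  have := (hχ.ruling_line hD (sub_ne_zero.2 h.ne.symm) (h.hess_dir hχ hD ht.1 (ht.2.trans h1))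
    (h.hess_ne ht.1 (ht.2.trans h1)) (S := s - t) (by linarith [ht.2]) (fun r hr => by
      rw [e]; exact h.mem (by linarith [hr.1, ht.1]) (by linarith [hr.2]))
    (s := s - t) ⟨by linarith [ht.2], le_rfl⟩).2.2
  rwa [e, add_sub_cancel] at this

/-- The rulings with a common endpoint are parallel. -/
theorem IsRuling.parallel (hχ : IsIsometricImmersion D χ) (hD : IsOpen D) {p q q' : Plane}
    (h : IsRuling D χ p q) (h' : IsRuling D χ p q') : ∃ r : ℝ, r ≠ 0 ∧ q' - p = r • (q - p) := by
  obtain ⟨-, Hp, -, -, hHp, -⟩ := hχ.exists_boundary_jet hD (frontier_subset_closure h.left_mem)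
  obtain ⟨h1, hne⟩ := h.boundary_hess hχ hD hHp
  obtain ⟨h2, -⟩ := h'.boundary_hess hχ hD hHp
  have hv : q - p ≠ 0 := sub_ne_zero.2 h.ne.symm
  have := mem_closure_iff_nhdsWithin_neBot.1 (frontier_subset_closure h.left_mem)
  have hs : ∀ u v, Hp u v = Hp v u := fun u v => by
    refine tendsto_nhds_unique (tendsto_clm_apply (tendsto_clm_apply hHp u) v)
      ((tendsto_clm_apply (tendsto_clm_apply hHp v) u).congr' ?_)
    filter_upwards [self_mem_nhdsWithin] with x hx using hχ.hess_symm hD hx v u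
  obtain ⟨r, b, e⟩ := exists_eq_smul_add_smul_rot hv (q' - p)
  have hb : b = 0 := by
    by_contra hb
    refine hne (hess_eq_zero_of_rot hs hv h1 ?_)
    have h3 := congrArg (fun L : Plane →L[ℝ] Space => L (rot (q - p))) h2
    rw [e] at h3
    simpa [h1, hb] using h3
  rw [hb, zero_smul, add_zero] at e
  refine ⟨r, ?_, e⟩
  rintro rfl
  rw [zero_smul, sub_eq_zero] at e
  exact h'.ne e.symm

/-- Of two different rulings on one ray, the longer would have the end of the shorter, a boundary
point, in its interior. -/
theorem IsRuling.eq_of_pos (hD : IsOpen D) {p q q' : Plane} (h : IsRuling D χ p q)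
    (h' : IsRuling D χ p q') {r : ℝ} (hr : 0 < r) (e : q' - p = r • (q - p)) : q' = q := by
  have key : ∀ {q q' : Plane}, IsRuling D χ p q → IsRuling D χ p q' → ∀ {r : ℝ}, 0 < r →
      q' - p = r • (q - p) → 1 ≤ r := by
    intro q q' h h' r hr e
    by_contra! hlt
    have := h.mem hr hlt
    rw [← e, add_sub_cancel] at this
    exact (hD.inter_frontier_eq.subset ⟨this, h'.right_mem⟩)
  have h1 := key h h' hr e
  have h2 := key h' h (inv_pos.2 hr) (by rw [e, smul_smul, inv_mul_cancel₀ hr.ne', one_smul])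
  have : r = 1 := le_antisymm ((one_le_inv₀ hr).1 h2) h1
  rw [this, one_smul] at e
  exact sub_left_injective e

end RuledImmersion

/-! ### Constructing rulings and continuing them through a boundary point. -/

namespace RuledImmersion

variable {D : Set Plane} {χ : Plane → Space}

/-- A ray from a boundary point that starts in `D` in the kernel direction of a nonvanishing second
derivative carries a ruling. -/
theorem IsIsometricImmersion.exists_ruling_of_ray (hχ : IsIsometricImmersion D χ) (hD : IsOpen D)
    (hb : Bornology.IsBounded D) {p u : Plane} (hp : p ∈ frontier D) (hu : u ≠ 0) {t : ℝ}
    (ht : 0 < t) (hray : ∀ s, 0 < s → s ≤ t → p + s • u ∈ D)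
    (h0 : fderiv ℝ (fderiv ℝ χ) (p + t • u) u = 0)
    (hne : fderiv ℝ (fderiv ℝ χ) (p + t • u) ≠ 0) :
    ∃ r : ℝ, 0 < r ∧ IsRuling D χ p (p + r • u) := by
  have hu' : 0 < ‖u‖ := norm_pos_iff.2 hu
  -- The infimum of `E` is the first exit from `D` after `t`; boundedness of `D` makes `E` nonempty.
  let E : Set ℝ := Ici t ∩ (fun s : ℝ => p + s • u) ⁻¹' Dᶜ
  have hEc : IsClosed E := isClosed_Ici.inter (hD.isClosed_compl.preimage (continuous_line p u))
  have hEb : BddBelow E := ⟨t, fun s hs => hs.1⟩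
  have hEn : E.Nonempty := by
    obtain ⟨R, hR⟩ := hb.exists_norm_le
    refine ⟨max t ((R + ‖p‖ + 1) / ‖u‖), mem_Ici.2 (le_max_left _ _), fun hmem => ?_⟩
    set s := max t ((R + ‖p‖ + 1) / ‖u‖)
    have h1 := hR _ hmem
    have h2 : R + ‖p‖ + 1 ≤ s * ‖u‖ := (div_le_iff₀ hu').1 (le_max_right _ _)
    have h3 : ‖s • u‖ ≤ ‖p + s • u‖ + ‖p‖ := by
      simpa using norm_sub_le (p + s • u) p
    rw [norm_smul, Real.norm_eq_abs, abs_of_pos (ht.trans_le (le_max_left _ _))] at h3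
    linarith
  obtain ⟨htT, hTD⟩ : sInf E ∈ E := hEc.csInf_mem hEn hEb
  set T := sInf E
  have htT' : t < T := by
    refine lt_of_le_of_ne htT fun h => hTD ?_
    rw [← h]
    exact hray t ht le_rfl
  have hT : 0 < T := ht.trans htT'
  have hmem : ∀ s, 0 < s → s < T → p + s • u ∈ D := by
    intro s h1 h2
    by_contra hs
    rcases le_or_gt s t with h3 | h3
    · exact hs (hray s h1 h3)
    · exact h2.not_ge (csInf_le hEb ⟨h3.le, hs⟩)
  have hcl : ∀ s ∈ Icc 0 T, p + s • u ∈ closure D := by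
    intro s hs
    rw [← closure_Ioo hT.ne] at hs
    exact map_mem_closure (f := fun s : ℝ => p + s • u) (continuous_line p u) hs fun s hs => hmem s hs.1 hs.2
  have hline : ∀ s, 0 < s → s < T → fderiv ℝ (fderiv ℝ χ) (p + s • u) ≠ 0 ∧
      fderiv ℝ χ (p + s • u) = fderiv ℝ χ (p + t • u) := by
    intro s h1 h2
    rcases le_total t s with h3 | h3
    · have e : ∀ r : ℝ, p + t • u + r • u = p + (t + r) • u := fun r => by module
      have := hχ.ruling_line hD hu h0 hne (S := s - t) (by linarith) (fun r hr => by
        rw [e]; exact hmem _ (by linarith [hr.1]) (by linarith [hr.2]))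
        (s := s - t) ⟨by linarith, le_rfl⟩
      rw [e, add_sub_cancel] at this
      exact this.2
    · have e : ∀ r : ℝ, p + t • u + r • -u = p + (t - r) • u := fun r => by module
      have := hχ.ruling_line hD (neg_ne_zero.2 hu) (by rw [map_neg, h0, neg_zero]) hne
        (S := t - s) (by linarith) (fun r hr => by
        rw [e]; exact hmem _ (by linarith [hr.2]) (by linarith [hr.1]))
        (s := t - s) ⟨by linarith, le_rfl⟩
      rw [e, sub_sub_cancel] at this
      exact this.2
  have hseg : ∀ x ∈ openSegment ℝ p (p + T • u), ∃ s, 0 < s ∧ s < T ∧ x = p + s • u := by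
    rintro x ⟨a, b, ha, hb, hab, rfl⟩
    refine ⟨b * T, by positivity, ?_, ?_⟩
    · nlinarith
    · rw [show a = 1 - b by linarith]; module
  have hd : ∀ s ∈ Ioo 0 T, HasDerivAt
      (fun s : ℝ => χ (p + s • u) - s • fderiv ℝ χ (p + t • u) u) 0 s := by
    intro s hs
    have h1 : HasDerivAt (fun s : ℝ => p + s • u) ((1 : ℝ) • u) s :=
      ((hasDerivAt_id s).smul_const u).const_add p
    have h2 := (hχ.hasFDerivAt hD (hmem s hs.1 hs.2)).comp_hasDerivAt s h1
    have h3 := h2.sub ((hasDerivAt_id s).smul_const (fderiv ℝ χ (p + t • u) u))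
    rw [(hline s hs.1 hs.2).2, one_smul, one_smul, sub_self] at h3
    exact h3
  have hconst : EqOn (fun s : ℝ => χ (p + s • u) - s • fderiv ℝ χ (p + t • u) u)
      (fun _ => χ (p + t • u) - t • fderiv ℝ χ (p + t • u) u) (Icc 0 T) := by
    refine EqOn.of_subset_closure (s := Ioo 0 T) (fun s hs => ?_) ?_ continuousOn_const
      Ioo_subset_Icc_self (closure_Ioo hT.ne).ge
    · exact isOpen_Ioo.is_const_of_deriv_eq_zero isPreconnected_Ioo
        (fun x hx => (hd x hx).differentiableAt.differentiableWithinAt)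
        (fun x hx => (hd x hx).deriv) hs ⟨ht, htT'⟩
    · exact (hχ.contDiffOn.continuousOn.comp (continuous_line p u).continuousOn hcl).sub
        (by fun_prop)
  have hval : ∀ s ∈ Icc 0 T, χ (p + s • u) = χ p + s • fderiv ℝ χ (p + t • u) u := by
    intro s hs
    have := (hconst hs).trans (hconst ⟨le_rfl, hT.le⟩).symm
    simp only [zero_smul, add_zero, sub_zero] at this
    rw [← this]
    abel
  refine ⟨T, hT, ?_, hp, ?_, ?_, ?_, ?_⟩
  · simpa using ⟨hT.ne', hu⟩
  · rw [hD.frontier_eq]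
    exact ⟨hcl T ⟨hT.le, le_rfl⟩, hTD⟩
  · intro x hx
    obtain ⟨s, h1, h2, rfl⟩ := hseg x hx
    exact hmem s h1 h2
  · intro x hx
    obtain ⟨s, h1, h2, rfl⟩ := hseg x hx
    exact (hline s h1 h2).1
  · intro s hs
    have e : AffineMap.lineMap p (p + T • u) s = p + (s * T) • u := by
      rw [AffineMap.lineMap_apply_module']; module
    rw [e, hval _ ⟨by nlinarith [hs.1], by nlinarith [hs.2]⟩, hval T ⟨hT.le, le_rfl⟩,
      AffineMap.lineMap_apply_module']
    module

theorem clm_eq_zero_of_smul {L : Plane →L[ℝ] Space} {r : ℝ} (hr : r ≠ 0) (h : r • L = 0) :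
    L = 0 := by
  ext1 x
  have := congrArg (fun L : Plane →L[ℝ] Space => L x) h
  simpa [hr] using this

theorem exists_eventually_le_norm_sub {F : Type*} [NormedAddCommGroup F] [NormedSpace ℝ F]
    {f : ℝ → F} {f' : F} {x : ℝ} (hf : HasDerivAt f f' x) (hf' : f' ≠ 0) :
    ∃ c > 0, ∀ᶠ y in 𝓝 x, c * |y - x| ≤ ‖f y - f x‖ := by
  obtain ⟨C, hC, hb⟩ := (hf.isTheta_sub hf').2.exists_pos
  have hb' := hb.bound
  rw [prod_pure, eventually_map] at hb'
  refine ⟨C⁻¹, inv_pos.2 hC, hb'.mono fun y hy => ?_⟩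
  rw [inv_mul_le_iff₀ hC]
  exact hy

theorem affine_pos {k m r s : ℝ} (hk : 0 < k) (h : 0 < k + m * r) (h0 : 0 ≤ s) (h1 : s ≤ r) :
    0 < k + m * s := by
  rcases le_total 0 m with hm | hm
  · nlinarith [mul_nonneg hm h0]
  · nlinarith [mul_le_mul_of_nonpos_left h1 hm]

theorem affine_lt {k m r s : ℝ} (hk : k < r) (hm : |m| < 1) (h0 : 0 ≤ s) (h1 : s ≤ r) :
    k + m * s < 2 * r := by
  nlinarith [mul_le_mul_of_nonneg_right (abs_lt.1 hm).2.le h0]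

/-- The hypothesis bounds the slope `m` by a multiple of the height `k`. Over the length chosen here
a line of that slope, followed backwards from height `k`, descends at most halfway. -/
theorem mul_le_half_of_bound {c C k m r : ℝ} (hc : 0 < c) (hC : 0 < C) (hk : 0 < k)
    (hr : 0 < r) (h : c * (k + m * r) ≤ C * k) : m * min r (c * r / (2 * C)) ≤ k / 2 := by
  have ht : 0 < min r (c * r / (2 * C)) := lt_min hr (by positivity)
  rcases le_total m 0 with h0 | h0
  · have := mul_nonneg_of_nonpos_of_nonpos h0 (neg_nonpos.2 ht.le)
    linarith
  · refine (mul_le_mul_of_nonneg_left (min_le_right _ _) h0).trans ?_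
    rw [show m * (c * r / (2 * C)) = c * (m * r) / (2 * C) by ring,
      div_le_div_iff₀ (by positivity) two_pos]
    nlinarith [mul_pos hc hk]

set_option maxHeartbeats 400000 in
/-- If `D` contains a half disc about the boundary point `p`, punctured at `p`, and a ruling starts
at `p` along its diameter, then a second ruling starts at `p` in the opposite direction. -/
theorem IsRuling.exists_opposite (hχ : IsIsometricImmersion D χ) (hD : IsOpen D)
    (hb : Bornology.IsBounded D) {p q : Plane} (h : IsRuling D χ p q) {σ δ : ℝ} (hσ : σ ≠ 0)
    (hδ : 0 < δ) (hδ1 : δ < 1) (hQ : ∀ x y : ℝ, |x| < δ → 0 ≤ y → y < δ → (x ≠ 0 ∨ y ≠ 0) →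
      p + x • (q - p) + y • σ • rot (q - p) ∈ D) :
    ∃ r : ℝ, 0 < r ∧ IsRuling D χ p (p + r • -(q - p)) := by
  obtain ⟨Gp, Hp, C₀, hGp, hHp, -, hC₀⟩ :=
    hχ.exists_boundary_jet hD (frontier_subset_closure h.left_mem)
  obtain ⟨hHpv, hHpne⟩ := h.boundary_hess hχ hD hHp
  have hG : ∀ s : ℝ, 0 < s → s < 1 → fderiv ℝ χ (p + s • (q - p)) = Gp := fun s h0 h1 =>
    h.fderiv_eq_boundary hχ hD hGp h0 h1
  have hHv : ∀ s : ℝ, 0 < s → s < 1 → fderiv ℝ (fderiv ℝ χ) (p + s • (q - p)) (q - p) = 0 :=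
    fun s h0 h1 => h.hess_dir hχ hD h0 h1
  have hHne : ∀ s : ℝ, 0 < s → s < 1 → fderiv ℝ (fderiv ℝ χ) (p + s • (q - p)) ≠ 0 :=
    fun s h0 h1 => h.hess_ne h0 h1
  have hv : q - p ≠ 0 := sub_ne_zero.2 h.ne.symm
  have hpf := h.left_mem
  have hnb := mem_closure_iff_nhdsWithin_neBot.1 (frontier_subset_closure hpf)
  have hsymm : ∀ u v, Hp u v = Hp v u := fun u v => by
    refine tendsto_nhds_unique (tendsto_clm_apply (tendsto_clm_apply hHp u) v)
      ((tendsto_clm_apply (tendsto_clm_apply hHp v) u).congr' ?_)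
    filter_upwards [self_mem_nhdsWithin] with x hx using hχ.hess_symm hD hx v u
  generalize hvdef : q - p = v at *
  clear h hvdef
  obtain ⟨w, hw⟩ : ∃ w, w = σ • rot v := ⟨_, rfl⟩
  simp only [← hw] at hQ
  -- nonvanishing across `v`
  have hww : ∀ B : Plane →L[ℝ] Plane →L[ℝ] Space, (∀ h k, B h k = B k h) → B v = 0 →
      B w = 0 → B = 0 := by
    intro B hs h1 h2
    refine hess_eq_zero_of_rot hs hv h1 ?_
    rw [hw, map_smul] at h2
    rw [clm_eq_zero_of_smul hσ h2]
    rfl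
  let Q : ℝ → ℝ → Plane := fun x y => p + x • v + y • w
  have hQ0 : ∀ x, Q x 0 = p + x • v := fun x => by simp [Q]
  have hadd : ∀ k m s : ℝ, Q 0 k + s • (v + m • w) = Q s (k + m * s) := fun k m s => by
    simp only [Q]; module
  have hsub : ∀ k m s : ℝ, Q 0 k + s • -(v + m • w) = Q (-s) (k - m * s) := fun k m s => by
    simp only [Q]; module
  have hQc : Continuous fun z : ℝ × ℝ => Q z.1 z.2 := by fun_prop
  -- approach to `p` from above
  have hk0 : Tendsto (fun k : ℝ => Q 0 k) (𝓝[>] 0) (𝓝[D] p) := by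
    refine tendsto_nhdsWithin_iff.2 ⟨?_, ?_⟩
    · have : Tendsto (fun k : ℝ => Q 0 k) (𝓝 0) (𝓝 (Q 0 0)) := Continuous.tendsto (by fun_prop) 0
      rw [hQ0, zero_smul, add_zero] at this
      exact this.mono_left nhdsWithin_le_nhds
    · filter_upwards [Ioo_mem_nhdsGT hδ] with k hk
      exact hQ 0 k (by simpa using hδ) hk.1.le hk.2 (Or.inr hk.1.ne')
  set a := Hp w w with ha
  have hane : a ≠ 0 := by
    intro h0
    refine hHpne (hess_eq_zero_of_rot hsymm hv hHpv ?_)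
    rw [ha, hw, map_smul, map_smul, smul_apply] at h0
    simpa [hσ] using h0
  let α : ℝ → ℝ := fun k => inner ℝ a (fderiv ℝ (fderiv ℝ χ) (Q 0 k) w w)
  let γ : ℝ → ℝ := fun k => inner ℝ a (fderiv ℝ (fderiv ℝ χ) (Q 0 k) v w)
  -- The slope solves `γ + m α = 0`, so that `v + m k • w` is the kernel direction at height `k`.
  let m : ℝ → ℝ := fun k => -γ k / α k
  have hα : Tendsto α (𝓝[>] 0) (𝓝 (inner ℝ a a)) :=
    tendsto_const_nhds.inner (tendsto_clm_apply (tendsto_clm_apply (hHp.comp hk0) w) w)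
  have hγ : Tendsto γ (𝓝[>] 0) (𝓝 0) := by
    have : Tendsto γ (𝓝[>] 0) (𝓝 (inner ℝ a (Hp v w))) :=
      tendsto_const_nhds.inner (tendsto_clm_apply (tendsto_clm_apply (hHp.comp hk0) v) w)
    rwa [hHpv, zero_apply, inner_zero_right] at this
  have haa : inner ℝ a a ≠ (0 : ℝ) := by simpa using hane
  have hm : Tendsto m (𝓝[>] 0) (𝓝 0) := by
    have := hγ.neg.div hα haa
    rw [neg_zero, zero_div] at this
    exact this
  have hid : Tendsto (fun k : ℝ => k) (𝓝[>] 0) (𝓝 0) := tendsto_id.mono_left nhdsWithin_le_nhds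
  have hkm : ∀ t : ℝ, Tendsto (fun k => k + m k * t) (𝓝[>] 0) (𝓝 0) := fun t => by
    simpa using hid.add (hm.mul_const t)
  have hker : ∀ᶠ k in 𝓝[>] (0 : ℝ), Q 0 k ∈ D ∧
      fderiv ℝ (fderiv ℝ χ) (Q 0 k) (v + m k • w) = 0 ∧ fderiv ℝ (fderiv ℝ χ) (Q 0 k) ≠ 0 := by
    filter_upwards [hα.eventually_ne haa, hk0.eventually self_mem_nhdsWithin] with k hk hkD
    refine ⟨hkD, hχ.hess_eq_zero_of_inner hD hkD hk ?_, fun h0 => hk ?_⟩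
    · rw [map_add, map_smul, add_apply, smul_apply,
        inner_add_right, inner_smul_right]
      change γ k + -γ k / α k * α k = 0
      rw [div_mul_cancel₀ _ hk, add_neg_cancel]
    · change inner ℝ a (fderiv ℝ (fderiv ℝ χ) (Q 0 k) w w) = 0
      rw [h0]
      simp
  have hd0 : ∀ (k : ℝ), v + m k • w ≠ 0 := by
    intro k h0
    have h1 := congrArg (fun z : Plane => z 0 * v 0 + z 1 * v 1) h0
    refine hv ?_
    simp [hw, rot] at h1
    ext i
    fin_cases i <;> simp <;> nlinarith [sq_nonneg (v 0), sq_nonneg (v 1)]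
  clear_value m
  -- bounds for the gradient
  set r := δ / 2 with hr
  have hr0 : 0 < r := by positivity
  have hrδ : r < δ := by linarith
  have hrD : Q r 0 ∈ D := hQ r 0 (by rwa [abs_of_pos hr0]) le_rfl hδ (Or.inl hr0.ne')
  -- At distance `r` along the given ruling the gradient changes at a definite rate across it,
  -- because the second derivative does not vanish there.
  obtain ⟨c, hc, hlow⟩ : ∃ c > 0, ∀ᶠ y in 𝓝 (0 : ℝ), c * |y| ≤ ‖fderiv ℝ χ (Q r y) - Gp‖ := by
    have hl : HasDerivAt (fun y : ℝ => Q r y) w 0 :=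
      (((hasDerivAt_id (0 : ℝ)).smul_const w).const_add (p + r • v)).congr_deriv (one_smul _ _)
    have h1 := (hχ.hasFDerivAt_fderiv hD hrD).comp_hasDerivAt (0 : ℝ) hl
    have h2 : fderiv ℝ (fderiv ℝ χ) (Q r 0) w ≠ 0 := by
      intro h0
      rw [hQ0] at h0
      refine hHne r hr0 (by linarith) (hww _ ?_ (hHv r hr0 (by linarith)) h0)
      rw [hQ0] at hrD
      exact hχ.hess_symm hD hrD
    obtain ⟨c, hc, hc'⟩ := exists_eventually_le_norm_sub h1 h2
    refine ⟨c, hc, hc'.mono fun y hy => ?_⟩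
    rw [← hG r hr0 (by linarith), ← hQ0]
    simpa using hy
  obtain ⟨C, hC, hup⟩ : ∃ C > 0, ∀ᶠ k in 𝓝[>] (0 : ℝ), ‖fderiv ℝ χ (Q 0 k) - Gp‖ ≤ C * k := by
    refine ⟨|C₀| * ‖w‖ + 1, by positivity, ?_⟩
    filter_upwards [hk0.eventually hC₀, self_mem_nhdsWithin] with k hk hk'
    rw [mem_Ioi] at hk'
    have e : Q 0 k - p = k • w := by simp only [Q]; module
    rw [e, norm_smul, Real.norm_eq_abs, abs_of_pos hk'] at hk
    have := mul_le_mul_of_nonneg_right (le_abs_self C₀) (by positivity : 0 ≤ k * ‖w‖)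
    nlinarith
  -- the ruling through a point above `p` does not meet the given one
  have hpos : ∀ᶠ k in 𝓝[>] (0 : ℝ), 0 < k + m k * r := by
    filter_upwards [hker, Ioo_mem_nhdsGT hδ] with k hk hkδ
    obtain ⟨-, hk1, hk2⟩ := hk
    by_contra! hle
    have hmr : m k * r < 0 := by linarith [hkδ.1]
    have hmneg : m k < 0 := neg_of_mul_neg_left hmr hr0.le
    set s₁ := -k / m k with hs₁
    have hs₁m : m k * s₁ = -k := by
      rw [hs₁, mul_div_cancel₀ _ hmneg.ne]
    have hs₁0 : 0 < s₁ := div_pos_of_neg_of_neg (by linarith [hkδ.1]) hmneg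
    have hs₁r : s₁ ≤ r := by
      refine (mul_le_mul_left_of_neg hmneg).1 ?_
      linarith
    have hline := hχ.ruling_line hD (hd0 k) hk1 hk2 (S := s₁) hs₁0.le (fun s hs => by
      rw [hadd]
      refine hQ s _ (by rw [abs_of_nonneg hs.1]; linarith [hs.2]) 
        (by linarith [mul_le_mul_of_nonpos_left hs.2 hmneg.le])
        (by linarith [hkδ.2, mul_nonpos_of_nonpos_of_nonneg hmneg.le hs.1]) ?_
      by_cases h0 : s = 0
      · right; rw [h0]; simpa using hkδ.1.ne'
      · exact Or.inl h0) (s := s₁) ⟨hs₁0.le, le_rfl⟩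
    -- At the crossing both `v` and the direction of the other line are in the kernel, so the second
    -- derivative would be zero.
    rw [hadd, hs₁m, add_neg_cancel] at hline
    have hD1 : Q s₁ 0 ∈ D :=
      hQ s₁ 0 (by rw [abs_of_pos hs₁0]; linarith) le_rfl hδ (Or.inl hs₁0.ne')
    obtain ⟨l1, l2, -⟩ := hline
    have l3 : fderiv ℝ (fderiv ℝ χ) (Q s₁ 0) v = 0 := by
      rw [hQ0]; exact hHv s₁ hs₁0 (by linarith)
    rw [map_add, l3, zero_add, map_smul] at l1
    exact l2 (hww _ (hχ.hess_symm hD hD1) l3 (clm_eq_zero_of_smul hmneg.ne l1))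
  set t₀ := min r (c * r / (2 * C)) with ht₀
  have ht₀0 : 0 < t₀ := lt_min hr0 (by positivity)
  have ht₀r : t₀ ≤ r := min_le_left _ _
  -- The gradient is constant along the line through `Q 0 k`. The lower bound at abscissa `r` and
  -- the upper bound at abscissa `0` control its slope, so backwards to `-t₀` it stays inside the
  -- half disc.
  have hback : ∀ᶠ k in 𝓝[>] (0 : ℝ), ∀ t ∈ Icc 0 t₀,
      fderiv ℝ χ (Q (-t) (k - m k * t)) = fderiv ℝ χ (Q 0 k) := by
    have hsmall : ∀ᶠ k in 𝓝[>] (0 : ℝ), |m k| < 1 := by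
      have := hm.abs
      rw [abs_zero] at this
      exact this.eventually_lt_const one_pos
    filter_upwards [hker, hpos, hup, (hkm r).eventually hlow, hsmall, Ioo_mem_nhdsGT hr0]
      with k hk hkpos hkup hklow hkm hkδ t ht
    obtain ⟨-, hk1, hk2⟩ := hk
    have hright := (hχ.ruling_line hD (hd0 k) hk1 hk2 (S := r) hr0.le (fun s hs => by
      rw [hadd]
      have hpos' := affine_pos hkδ.1 hkpos hs.1 hs.2
      refine hQ s _ (by rw [abs_of_nonneg hs.1]; linarith [hs.2]) hpos'.le ?_ (Or.inr hpos'.ne')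
      linarith [affine_lt hkδ.2 hkm hs.1 hs.2]) (s := r) ⟨hr0.le, le_rfl⟩).2.2
    rw [hadd] at hright
    rw [hright, abs_of_pos hkpos] at hklow
    have hklow' : c * (k + m k * r) ≤ C * k := hklow.trans hkup
    have hmt : m k * t₀ ≤ k / 2 := mul_le_half_of_bound hc hC hkδ.1 hr0 hklow'
    have hend : 0 < k + -m k * t₀ := by linarith [hkδ.1]
    have hkm' : |-m k| < 1 := by rwa [abs_neg]
    have hleft := (hχ.ruling_line hD (neg_ne_zero.2 (hd0 k)) (by rw [map_neg, hk1, neg_zero]) hk2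
      (S := t) ht.1 (fun s hs => by
      rw [hsub, sub_eq_add_neg, ← neg_mul]
      have hst := hs.2.trans ht.2
      have hpos' := affine_pos hkδ.1 hend hs.1 hst
      refine hQ _ _ (by rw [abs_neg, abs_of_nonneg hs.1]; linarith) hpos'.le ?_ (Or.inr hpos'.ne')
      linarith [affine_lt hkδ.2 hkm' hs.1 (hst.trans ht₀r)]) (s := t) ⟨ht.1, le_rfl⟩).2.2
    rwa [hsub] at hleft
  have hDt : ∀ t, 0 < t → t < δ → Q (-t) 0 ∈ D := fun t h0 h1 =>
    hQ (-t) 0 (by rwa [abs_neg, abs_of_pos h0]) le_rfl hδ (Or.inl (by linarith))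
  -- As `k` tends to zero these lines approach the opposite half of the diameter, which therefore
  -- inherits the gradient at `p`.
  have hGt : ∀ t, 0 < t → t ≤ t₀ → fderiv ℝ χ (Q (-t) 0) = Gp := by
    intro t h0 h1
    have hc1 : Tendsto (fun k => Q (-t) (k - m k * t)) (𝓝[>] 0) (𝓝 (Q (-t) 0)) := by
      have h2 : Tendsto (fun k => k - m k * t) (𝓝[>] 0) (𝓝 0) := by
        simpa [sub_eq_add_neg] using hkm (-t)
      exact Tendsto.comp (g := fun z : ℝ × ℝ => Q z.1 z.2) (f := fun k => (-t, k - m k * t))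
        (hQc.tendsto (-t, 0)) (tendsto_const_nhds.prodMk_nhds h2)
    have hcont : ContinuousAt (fderiv ℝ χ) (Q (-t) 0) :=
      (hχ.hasFDerivAt_fderiv hD (hDt t h0 (by linarith))).continuousAt
    have hc2 := hcont.tendsto.comp hc1
    refine tendsto_nhds_unique hc2 ((hGp.comp hk0).congr' ?_)
    filter_upwards [hback] with k hk using (hk t ⟨h0.le, h1⟩).symm
  have hHt : ∀ t, 0 < t → t < t₀ → fderiv ℝ (fderiv ℝ χ) (Q (-t) 0) v = 0 := by
    intro t h0 h1
    have hl : HasDerivAt (fun t : ℝ => Q (-t) 0) (-v) t := by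
      have := ((hasDerivAt_id t).neg.smul_const v).const_add p
      simpa [Q] using this
    have h2 := (hχ.hasFDerivAt_fderiv hD (hDt t h0 (by linarith))).comp_hasDerivAt t hl
    have h3 := h2.unique ((hasDerivAt_const t Gp).congr_of_eventuallyEq (by
      filter_upwards [Ioo_mem_nhds h0 h1] with s hs using hGt s hs.1 hs.2.le))
    rw [map_neg] at h3
    exact neg_eq_zero.1 h3
  have hlim : Tendsto (fun t : ℝ => Q (-t) 0) (𝓝[>] 0) (𝓝[D] p) := by
    refine tendsto_nhdsWithin_iff.2 ⟨?_, ?_⟩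
    · have : Tendsto (fun t : ℝ => Q (-t) 0) (𝓝 0) (𝓝 (Q (-0) 0)) :=
        Continuous.tendsto (by fun_prop) 0
      rw [hQ0, neg_zero, zero_smul, add_zero] at this
      exact this.mono_left nhdsWithin_le_nhds
    · filter_upwards [Ioo_mem_nhdsGT hδ] with t ht using hDt t ht.1 ht.2
  obtain ⟨t, htne, ht⟩ :=
    (((hHp.comp hlim).eventually_ne hHpne).and (Ioo_mem_nhdsGT ht₀0)).exists
  have e : ∀ s : ℝ, p + s • -v = Q (-s) 0 := fun s => by simp only [Q]; module
  refine hχ.exists_ruling_of_ray hD hb hpf (neg_ne_zero.2 hv) ht.1 (fun s h0 h1 => ?_) ?_ ?_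
  · rw [e]; exact hDt s h0 (by linarith [ht.2])
  · rw [e, map_neg, hHt t ht.1 ht.2, neg_zero]
  · rw [e]; exact htne

end RuledImmersion

/-! ### The jump of the logarithmic integral across a curve. -/

namespace RuledImmersion

theorem integral_div_eq_log_sub {f f' : ℝ → ℂ} {a b : ℝ} (hab : a ≤ b) {F : Set ℝ}
    (hF : F.Countable) (hf : ContinuousOn f (Icc a b))
    (hd : ∀ t ∈ Ioo a b \ F, HasDerivAt f (f' t) t) (hs : ∀ t ∈ Icc a b, f t ∈ Complex.slitPlane)
    (hi : IntervalIntegrable (fun t => f' t / f t) volume a b) :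
    ∫ t in a..b, f' t / f t = Complex.log (f b) - Complex.log (f a) := by
  refine integral_eq_of_hasDerivAt_off_countable_of_le (fun t => Complex.log (f t)) _ hab hF
    (hf.clog hs) (fun t ht => ?_) hi
  exact (hd t ht).clog_real (hs t (Ioo_subset_Icc_self ht.1))

/-- A closed curve, given by a periodic parametrization that is differentiable off a countable set
and has a bounded derivative. -/
structure IsClosedCurve (z : ℝ → ℂ) (ℓ : ℝ) (F : Set ℝ) : Prop where
  continuous : Continuous z
  periodic : Function.Periodic z ℓ
  countable : F.Countable
  differentiableAt : ∀ t ∉ F, DifferentiableAt ℝ z t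
  norm_deriv_le : ∀ t, ‖deriv z t‖ ≤ 1

namespace IsClosedCurve

variable {z : ℝ → ℂ} {ℓ : ℝ} {F : Set ℝ}

theorem intervalIntegrable (hz : IsClosedCurve z ℓ F) {w : ℂ} {a b : ℝ}
    (hw : ∀ t ∈ uIcc a b, z t ≠ w) :
    IntervalIntegrable (fun t => deriv z t / (z t - w)) volume a b := by
  have h1 : IntervalIntegrable (deriv z) volume a b :=
    (intervalIntegrable_const (c := (1 : ℝ))).mono_fun
      (measurable_deriv z).aestronglyMeasurable (Eventually.of_forall fun t => by
        simpa using hz.norm_deriv_le t)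
  simp only [div_eq_mul_inv]
  refine h1.mul_continuousOn (ContinuousOn.inv₀ ?_ fun t ht => sub_ne_zero.2 (hw t ht))
  exact (hz.continuous.sub continuous_const).continuousOn

/-- The quotient of `z t - w` by `z t - w₀` stays in the unit disc about `1`, so its principal
logarithm is a closed primitive of the difference of the integrands. -/
theorem integral_eq_of_near (hz : IsClosedCurve z ℓ F) (hℓ : 0 ≤ ℓ) (a : ℝ) {w₀ w : ℂ} {r : ℝ}
    (h₀ : ∀ t, r ≤ ‖z t - w₀‖) (hw : ‖w - w₀‖ < r) :
    ∫ t in a..a + ℓ, deriv z t / (z t - w) = ∫ t in a..a + ℓ, deriv z t / (z t - w₀) := by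
  have hr : 0 < r := (norm_nonneg _).trans_lt hw
  have hne₀ : ∀ t, z t - w₀ ≠ 0 := fun t => norm_pos_iff.1 (hr.trans_le (h₀ t))
  have hne : ∀ t, z t - w ≠ 0 := fun t h => by
    have := h₀ t
    rw [sub_eq_zero.1 h] at this
    exact hw.not_ge this
  have hi := hz.intervalIntegrable (a := a) (b := a + ℓ) (fun t _ => sub_ne_zero.1 (hne t))
  have hi₀ := hz.intervalIntegrable (a := a) (b := a + ℓ) (fun t _ => sub_ne_zero.1 (hne₀ t))
  rw [← sub_eq_zero, ← intervalIntegral.integral_sub hi hi₀]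
  let f : ℝ → ℂ := fun t => (z t - w) / (z t - w₀)
  let f' : ℝ → ℂ := fun t =>
    (deriv z t * (z t - w₀) - (z t - w) * deriv z t) / (z t - w₀) ^ 2
  have e : ∀ t, deriv z t / (z t - w) - deriv z t / (z t - w₀) = f' t / f t := by
    intro t
    have h1 := hne t
    have h2 := hne₀ t
    simp only [f, f']
    field_simp
  have hii := hi.sub hi₀
  simp only [e] at hii ⊢
  rw [integral_div_eq_log_sub (by linarith) hz.countable ?_ ?_ ?_ hii]
  · simp only [f, hz.periodic a, sub_self]
  · exact ((hz.continuous.sub continuous_const).div (hz.continuous.sub continuous_const)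
      hne₀).continuousOn
  · intro t ht
    have hd := (hz.differentiableAt t ht.2).hasDerivAt
    exact (hd.sub_const w).div (hd.sub_const w₀) (hne₀ t)
  · intro t _
    refine Complex.mem_slitPlane_of_norm_lt_one (z := f t - 1) ?_ |> fun h => by
      simpa using h
    have : f t - 1 = (w₀ - w) / (z t - w₀) := by
      simp only [f]
      rw [div_sub_one (hne₀ t)]
      congr 1
      ring
    rw [this, norm_div, norm_sub_rev, div_lt_one (norm_pos_iff.2 (hne₀ t))]
    exact hw.trans_le (h₀ t)

theorem log_neg_sub_log_im {A : ℂ} (hA : A.im ≠ 0) :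
    (Complex.log (-A) - Complex.log A).im = if 0 < A.im then -Real.pi else Real.pi := by
  rw [Complex.sub_im, Complex.log_im, Complex.log_im]
  split_ifs with h
  · rw [Complex.arg_neg_eq_arg_sub_pi_of_im_pos h]; ring
  · rw [Complex.arg_neg_eq_arg_add_pi_of_im_neg (lt_of_le_of_ne (not_lt.1 h) hA)]; ring

theorem eventually_sign_of_hasDerivAt {g : ℝ → ℝ} {m α : ℝ} (hg : HasDerivAt g m α)
    (h0 : g α = 0) (hm : m ≠ 0) : ∀ᶠ t in 𝓝[≠] α, 0 < g t * m * (t - α) := by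
  have h1 : Tendsto (fun t => slope g α t * m) (𝓝[≠] α) (𝓝 (m * m)) :=
    (hasDerivAt_iff_tendsto_slope.1 hg).mul_const m
  filter_upwards [h1.eventually (lt_mem_nhds (mul_self_pos.2 hm)), self_mem_nhdsWithin]
    with t ht hne
  have hne' : t - α ≠ 0 := sub_ne_zero.2 hne
  rw [slope_def_field, h0, sub_zero] at ht
  have := mul_pos ht (mul_self_pos.2 hne')
  rw [show g t / (t - α) * m * ((t - α) * (t - α)) = g t / (t - α) * (t - α) * m * (t - α) by ring,
    div_mul_cancel₀ _ hne'] at this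
  exact this

/-- The logarithmic integral of a closed curve cannot take the same value on the two sides of a
regular simple point of the curve. -/
theorem not_same_integral (hz : IsClosedCurve z ℓ F) {α : ℝ} {τ d : ℂ}
    (hτ : HasDerivAt z τ α) (hd : d ≠ 0) (htr : (τ / d).im ≠ 0) (hℓ : 0 < ℓ)
    (hsimple : ∀ t ∈ Ioo α (α + ℓ), z t ≠ z α)
    (heq : ∀ᶠ ε : ℝ in 𝓝[>] 0, ∀ a, (∀ t, z t ≠ z α + ε * d) ∧ (∀ t, z t ≠ z α - ε * d) ∧
      ∫ t in a..a + ℓ, deriv z t / (z t - (z α + ε * d)) =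
        ∫ t in a..a + ℓ, deriv z t / (z t - (z α - ε * d))) : False := by
  -- In this coordinate the two test points are `ε` and `-ε`, and the curve crosses the real axis
  -- transversally at `0`.
  let ζ : ℝ → ℂ := fun t => (z t - z α) / d
  have hζc : Continuous ζ := (hz.continuous.sub continuous_const).div_const d
  have hζα : ζ α = 0 := by simp [ζ]
  have hζ' : HasDerivAt ζ (τ / d) α := (hτ.sub_const _).div_const d
  have him : HasDerivAt (fun t => (ζ t).im) (τ / d).im α :=
    Complex.imCLM.hasFDerivAt.comp_hasDerivAt α hζ'
  have hsign := eventually_sign_of_hasDerivAt him (by simp [hζα]) htr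
  rw [eventually_nhdsWithin_iff, Metric.eventually_nhds_iff] at hsign
  obtain ⟨η₁, hη₁, hsign⟩ := hsign
  obtain ⟨η, hη, hηη₀, hηη₁⟩ : ∃ η > 0, η ≤ ℓ / 4 ∧ η < η₁ :=
    ⟨min (ℓ / 4) (η₁ / 2), by positivity, min_le_left _ _, (min_le_right _ _).trans_lt (by linarith)⟩
  set m := (τ / d).im
  have hsign' : ∀ t ∈ Icc (α - η) (α + η), t ≠ α → 0 < (ζ t).im * m * (t - α) := by
    intro t ht hne
    refine hsign ?_ hne
    rw [Real.dist_eq, abs_lt]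
    constructor <;> linarith [ht.1, ht.2]
  -- the part of the curve away from the point
  obtain ⟨ρ, hρ, hfar⟩ : ∃ ρ > 0, ∀ t ∈ Icc (α + η) (α - η + ℓ), ρ ≤ ‖z t - z α‖ := by
    have hne : (Icc (α + η) (α - η + ℓ)).Nonempty := nonempty_Icc.2 (by linarith)
    obtain ⟨t₀, ht₀, hmin⟩ := isCompact_Icc.exists_isMinOn hne
      ((hz.continuous.sub continuous_const).norm (E := ℂ)).continuousOn (f := fun t => ‖z t - z α‖)
    exact ⟨‖z t₀ - z α‖, norm_pos_iff.2 (sub_ne_zero.2 (hsimple t₀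
      ⟨by linarith [ht₀.1], by linarith [ht₀.2]⟩)), fun t ht => hmin ht⟩
  -- The distant arc contributes continuously at `z α`, so any jump must come from the short arc.
  let R : ℂ → ℂ := fun w => ∫ t in (α + η)..(α - η + ℓ), deriv z t / (z t - w)
  have hlen : (α + η) ≤ α - η + ℓ := by linarith
  have hRlim : Tendsto (fun ε : ℝ => R (z α + ε * d) - R (z α - ε * d)) (𝓝[>] 0) (𝓝 0) := by
    have hlim : Tendsto (fun ε : ℝ => 2 * ε * ‖d‖ / ((ρ / 2) * (ρ / 2)) *
        |α - η + ℓ - (α + η)|) (𝓝[>] 0) (𝓝 0) := by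
      have : Tendsto (fun ε : ℝ => 2 * ε * ‖d‖ / ((ρ / 2) * (ρ / 2)) *
        |α - η + ℓ - (α + η)|) (𝓝 0) (𝓝 (2 * 0 * ‖d‖ / ((ρ / 2) * (ρ / 2)) *
        |α - η + ℓ - (α + η)|)) := Continuous.tendsto (by fun_prop) 0
      simpa using this.mono_left nhdsWithin_le_nhds
    refine squeeze_zero_norm' ?_ hlim
    have hdp : 0 < ‖d‖ := norm_pos_iff.2 hd
    filter_upwards [heq, Ioo_mem_nhdsGT (show 0 < ρ / 2 / ‖d‖ by positivity)] with ε hε hερ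
    obtain ⟨n1, n2, -⟩ := hε 0
    have hsm : ‖(ε : ℂ) * d‖ ≤ ρ / 2 := by
      rw [norm_mul, Complex.norm_real, Real.norm_eq_abs, abs_of_pos hερ.1]
      exact ((lt_div_iff₀ hdp).1 hερ.2).le
    rw [← intervalIntegral.integral_sub (hz.intervalIntegrable fun t _ => n1 t)
      (hz.intervalIntegrable fun t _ => n2 t)]
    refine intervalIntegral.norm_integral_le_of_norm_le_const fun t ht => ?_
    rw [uIoc_of_le hlen] at ht
    have hb := hfar t ⟨ht.1.le, ht.2⟩
    have b1 : ρ / 2 ≤ ‖z t - (z α + ε * d)‖ := by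
      have := norm_sub_norm_le (z t - z α) (ε * d)
      rw [sub_sub] at this
      linarith
    have b2 : ρ / 2 ≤ ‖z t - (z α - ε * d)‖ := by
      have := norm_sub_le (z t - (z α - ε * d)) (ε * d)
      rw [show z t - (z α - ε * d) - ε * d = z t - z α by ring] at this
      linarith
    have e : deriv z t / (z t - (z α + ε * d)) - deriv z t / (z t - (z α - ε * d)) =
        deriv z t * (2 * ε * d) / ((z t - (z α + ε * d)) * (z t - (z α - ε * d))) := by
      rw [div_sub_div _ _ (sub_ne_zero.2 (n1 t)) (sub_ne_zero.2 (n2 t))]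
      congr 1
      ring
    have e2 : ‖deriv z t * (2 * ε * d)‖ ≤ 2 * ε * ‖d‖ := by
      rw [norm_mul, norm_mul, norm_mul, Complex.norm_real, Real.norm_eq_abs, abs_of_pos hερ.1]
      simp only [Complex.norm_ofNat]
      exact mul_le_of_le_one_left (by have := hερ.1; positivity) (hz.norm_deriv_le t)
    rw [e, norm_div, norm_mul (z t - _)]
    have := hερ.1
    exact div_le_div₀ (by positivity) e2 (by positivity) (mul_le_mul b1 b2 (by positivity)
      (norm_nonneg _))
  -- the local part
  have hab : α - η ≤ α + η := by linarith
  -- The sign of the fraction is reversed so that the curve avoids the slit: it meets the real axis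
  -- only at `t = α`, where the value is `ε > 0`.
  have hplus : ∀ ε : ℝ, 0 < ε → (∀ t, z t ≠ z α + ε * d) →
      ∫ t in (α - η)..(α + η), deriv z t / (z t - (z α + ε * d)) =
        Complex.log (-(ζ (α + η)) + ε) - Complex.log (-(ζ (α - η)) + ε) := by
    intro ε hε hne
    have e : ∀ t, deriv z t / (z t - (z α + ε * d)) = (-(deriv z t / d)) / (-(ζ t) + ε) := by
      intro t
      have h1 : z t - (z α + ε * d) ≠ 0 := sub_ne_zero.2 (hne t)
      have h2 : -(ζ t) + ε = -(z t - (z α + ε * d)) / d := by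
        simp only [ζ]; field_simp; ring
      rw [h2]
      field_simp
    have hi := hz.intervalIntegrable (a := α - η) (b := α + η) (fun t _ => hne t)
    simp only [e] at hi ⊢
    refine integral_div_eq_log_sub (f := fun t => -(ζ t) + ε) hab hz.countable
      (by fun_prop) (fun t ht => ?_) (fun t ht => ?_) hi
    · exact ((((hz.differentiableAt t ht.2).hasDerivAt.sub_const _).div_const d).neg).add_const _
    · by_cases h : t = α
      · left; simpa [h, hζα] using hε
      · right
        have := hsign' t ht h
        intro h0
        have h0' : (ζ t).im = 0 := by simpa using h0
        rw [h0'] at this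
        simp at this
  have hminus : ∀ ε : ℝ, 0 < ε → (∀ t, z t ≠ z α - ε * d) →
      ∫ t in (α - η)..(α + η), deriv z t / (z t - (z α - ε * d)) =
        Complex.log (ζ (α + η) + ε) - Complex.log (ζ (α - η) + ε) := by
    intro ε hε hne
    have e : ∀ t, deriv z t / (z t - (z α - ε * d)) = (deriv z t / d) / (ζ t + ε) := by
      intro t
      have h1 : z t - (z α - ε * d) ≠ 0 := sub_ne_zero.2 (hne t)
      have h2 : ζ t + ε = (z t - (z α - ε * d)) / d := by
        simp only [ζ]; field_simp; ring
      rw [h2]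
      field_simp
    have hi := hz.intervalIntegrable (a := α - η) (b := α + η) (fun t _ => hne t)
    simp only [e] at hi ⊢
    refine integral_div_eq_log_sub (f := fun t => ζ t + ε) hab hz.countable
      (by fun_prop) (fun t ht => ?_) (fun t ht => ?_) hi
    · exact (((hz.differentiableAt t ht.2).hasDerivAt.sub_const _).div_const d).add_const _
    · by_cases h : t = α
      · left; simpa [h, hζα] using hε
      · right
        have := hsign' t ht h
        intro h0
        have h0' : (ζ t).im = 0 := by simpa using h0
        rw [h0'] at this
        simp at this
  set A := ζ (α - η)
  set B := ζ (α + η)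
  have hB : 0 < B.im * m := by
    have := hsign' (α + η) ⟨by linarith, le_rfl⟩ (by linarith)
    rw [add_sub_cancel_left] at this
    exact (pos_iff_pos_of_mul_pos this).2 hη
  have hA : B.im * A.im < 0 := by
    have h1 := hsign' (α - η) ⟨le_rfl, by linarith⟩ (by linarith)
    have h2 : A.im * m < 0 := by nlinarith
    have h3 : 0 < m * m := mul_self_pos.2 htr
    nlinarith [mul_neg_of_pos_of_neg hB h2]
  have hAne : A.im ≠ 0 := fun h => by rw [h] at hA; simp at hA
  have hBne : B.im ≠ 0 := fun h => by rw [h] at hA; simp at hA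
  -- Equal total integrals force the short-arc difference to zero. Its actual limit has imaginary
  -- part `±2π`, since `A` and `B` lie on opposite sides of the real axis.
  have hzero : Tendsto (fun ε : ℝ => (Complex.log (-B + ε) - Complex.log (-A + ε)) -
      (Complex.log (B + ε) - Complex.log (A + ε))) (𝓝[>] 0) (𝓝 0) := by
    have := hRlim.neg
    rw [neg_zero] at this
    refine this.congr' ?_
    filter_upwards [heq, self_mem_nhdsWithin] with ε hε hpos
    obtain ⟨n1, n2, h⟩ := hε (α - η)
    rw [← hplus ε hpos n1, ← hminus ε hpos n2]
    have h1 := intervalIntegral.integral_add_adjacent_intervals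
      (hz.intervalIntegrable (a := α - η) (b := α + η) fun t _ => n1 t)
      (hz.intervalIntegrable (b := α - η + ℓ) fun t _ => n1 t)
    have h2 := intervalIntegral.integral_add_adjacent_intervals
      (hz.intervalIntegrable (a := α - η) (b := α + η) fun t _ => n2 t)
      (hz.intervalIntegrable (b := α - η + ℓ) fun t _ => n2 t)
    simp only [R]
    linear_combination h2 - h1 - h
  have hlogc : ∀ {C : ℂ}, C.im ≠ 0 → Tendsto (fun ε : ℝ => Complex.log (C + ε)) (𝓝[>] 0)
      (𝓝 (Complex.log C)) := by
    intro C hC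
    have h1 : Tendsto (fun ε : ℝ => C + (ε : ℂ)) (𝓝 0) (𝓝 (C + ((0 : ℝ) : ℂ))) :=
      Continuous.tendsto (by fun_prop) 0
    rw [Complex.ofReal_zero, add_zero] at h1
    exact (h1.mono_left nhdsWithin_le_nhds).clog (Or.inr hC)
  have hlim := ((hlogc (C := -B) (by simpa using hBne)).sub
    (hlogc (C := -A) (by simpa using hAne))).sub ((hlogc hBne).sub (hlogc hAne))
  have hfin := congrArg Complex.im (tendsto_nhds_unique hlim hzero)
  have eB := log_neg_sub_log_im hBne
  have eA := log_neg_sub_log_im hAne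
  simp only [Complex.sub_im, Complex.zero_im] at hfin eA eB
  have hπ := Real.pi_pos
  rcases mul_neg_iff.1 hA with ⟨h1, h2⟩ | ⟨h1, h2⟩
  · rw [if_pos h1] at eB
    rw [if_neg h2.not_gt] at eA
    linarith
  · rw [if_neg h1.not_gt] at eB
    rw [if_pos h2] at eA
    linarith

end IsClosedCurve

end RuledImmersion

/-! ### The boundary curve as a closed curve, and the side on which the region lies. -/

namespace RuledImmersion

variable {D : Set Plane} {χ : Plane → Space} {ℓ : ℝ} {c : ℝ → Plane}

namespace IsReferenceRegion

theorem exists_finite_breaks (hD : IsReferenceRegion D ℓ c) :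
    ∃ B : Set ℝ, B.Finite ∧ 0 ∈ B ∧ ∀ α ∈ Ico 0 ℓ \ B, ContDiffAt ℝ 2 c α := by
  obtain ⟨n, t, ht, h0, hn, hc⟩ := hD.piecewise_C2
  refine ⟨t '' Iic n, (finite_Iic n).image t, ⟨0, Nat.zero_le n, h0⟩, ?_⟩
  rintro α ⟨hα, hαB⟩
  classical
  have hex : ∃ j, α < t j := ⟨n, by rw [hn]; exact hα.2⟩
  have hj := Nat.find_spec hex
  have hj' : Nat.find hex ≤ n := Nat.find_min' hex (by rw [hn]; exact hα.2)
  obtain ⟨i, hi⟩ : ∃ i, Nat.find hex = i + 1 := Nat.exists_eq_succ_of_ne_zero fun h => by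
    rw [h, h0] at hj
    exact hj.not_ge hα.1
  have hi' : t i ≤ α := not_lt.1 (Nat.find_min hex (by omega))
  rw [hi] at hj
  refine (hc i (by omega)).contDiffAt (Icc_mem_nhds (lt_of_le_of_ne hi' fun h => ?_) hj)
  exact hαB ⟨i, mem_Iic.2 (by omega), h⟩

theorem mem_frontier (hD : IsReferenceRegion D ℓ c) (t : ℝ) : c t ∈ frontier D := by
  obtain ⟨s, hs, e⟩ := hD.periodic.exists_mem_Ico₀ hD.length_pos t
  rw [e, ← hD.image_eq]
  exact mem_image_of_mem c hs

theorem notMem (hD : IsReferenceRegion D ℓ c) (t : ℝ) : c t ∉ D := fun h =>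
  hD.isOpen.inter_frontier_eq.subset ⟨h, hD.mem_frontier t⟩

theorem ne_of_mem_Ioo (hD : IsReferenceRegion D ℓ c) {α t : ℝ} (hα : α ∈ Ico 0 ℓ)
    (ht : t ∈ Ioo α (α + ℓ)) : c t ≠ c α := by
  intro h
  rcases lt_or_ge t ℓ with h1 | h1
  · exact ht.1.ne' (hD.injOn ⟨hα.1.trans ht.1.le, h1⟩ hα h)
  · have e : c (t - ℓ) = c α := by rw [hD.periodic.sub_eq, h]
    have := hD.injOn ⟨by linarith, by linarith [ht.2, hα.2]⟩ hα e
    linarith [ht.2]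

theorem norm_deriv_le (hD : IsReferenceRegion D ℓ c) (t : ℝ) : ‖deriv c t‖ ≤ 1 := by
  by_cases h : DifferentiableAt ℝ c t
  · exact (hD.arclength t h).le
  -- At a corner `deriv` has the default value zero, so the bound holds everywhere.
  · rw [deriv_zero_of_not_differentiableAt h]; simp

theorem countable_not_differentiable (hD : IsReferenceRegion D ℓ c) :
    {t | ¬ DifferentiableAt ℝ c t}.Countable := by
  obtain ⟨B, hB, -, hBc⟩ := hD.exists_finite_breaks
  refine (countable_iUnion fun k : ℤ => (hB.image fun b => b + k * ℓ).countable).mono ?_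
  intro t ht
  obtain ⟨k, hk, -⟩ := existsUnique_add_zsmul_mem_Ico hD.length_pos t 0
  rw [zero_add, zsmul_eq_mul] at hk
  refine mem_iUnion.2 ⟨-k, t + k * ℓ, ?_, by push_cast; ring⟩
  by_contra hnB
  refine ht ?_
  have h1 := (hBc _ ⟨hk, hnB⟩).differentiableAt (by norm_num)
  have h2 : c = fun s => c (s + k * ℓ) := by
    funext s
    exact (hD.periodic.int_mul k s).symm
  rw [h2]
  exact DifferentiableAt.comp t (g := c) (f := fun s => s + k * ℓ) h1 (by fun_prop)

theorem isPreconnected (hD : IsReferenceRegion D ℓ c) : IsPreconnected D := by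
  have := hD.simplyConnected
  exact (isPathConnected_iff_pathConnectedSpace.2 inferInstance).isConnected.isPreconnected

/-- `D` does not lie on both sides of a regular point of its boundary. -/
theorem not_both_sides (hD : IsReferenceRegion D ℓ c) {α : ℝ} (hα : α ∈ Ico 0 ℓ)
    (hc : DifferentiableAt ℝ c α) {d : Plane} (hd : d ≠ 0) (htr : ∀ r : ℝ, deriv c α ≠ r • d)
    (hside : ∀ᶠ ε : ℝ in 𝓝[>] 0, c α + ε • d ∈ D ∧ c α - ε • d ∈ D) : False := by
  let φ : Plane ≃ₗᵢ[ℝ] ℂ := Complex.orthonormalBasisOneI.repr.symm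
  have hder : ∀ t v, HasDerivAt c v t → HasDerivAt (fun s => φ (c s)) (φ v) t := fun t v h =>
    φ.toContinuousLinearEquiv.toContinuousLinearMap.hasFDerivAt.comp_hasDerivAt t h
  have hz : IsClosedCurve (fun t => φ (c t)) ℓ {t | ¬ DifferentiableAt ℝ c t} := by
    refine ⟨φ.continuous.comp hD.continuous, fun t => by rw [hD.periodic t],
      hD.countable_not_differentiable, fun t ht => ?_, fun t => ?_⟩
    · exact (hder t _ (not_not.1 ht).hasDerivAt).differentiableAt
    · by_cases h : DifferentiableAt ℝ c t
      · rw [(hder t _ h.hasDerivAt).deriv, φ.norm_map]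
        exact hD.norm_deriv_le t
      · by_cases h' : DifferentiableAt ℝ (fun t => φ (c t)) t
        · exfalso
          refine h ?_
          have := (φ.symm.toContinuousLinearEquiv.toContinuousLinearMap.differentiableAt
            (x := φ (c t))).comp t h'
          simpa [Function.comp_def] using this
        · rw [deriv_zero_of_not_differentiableAt h']; simp
  have hne : ∀ x ∈ D, ∀ t, φ (c t) ≠ φ x := fun x hx t h =>
    hD.notMem t (by rwa [φ.injective h])
  -- The integral is locally constant off the curve and `D` is connected, so it has one value on
  -- `D`.
  have hconst : ∀ a, ∀ x ∈ D, ∀ y ∈ D,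
      ∫ t in a..a + ℓ, deriv (fun t => φ (c t)) t / (φ (c t) - φ x) =
        ∫ t in a..a + ℓ, deriv (fun t => φ (c t)) t / (φ (c t) - φ y) := by
    intro a x hx y hy
    let N : Plane → ℂ := fun x => ∫ t in a..a + ℓ, deriv (fun t => φ (c t)) t / (φ (c t) - φ x)
    have hN : ∀ x ∈ D, HasFDerivAt N (0 : Plane →L[ℝ] ℂ) x := by
      intro x hx
      obtain ⟨r, hr, hball⟩ := Metric.isOpen_iff.1 hD.isOpen x hx
      refine (hasFDerivAt_const (N x) x).congr_of_eventuallyEq ?_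
      filter_upwards [Metric.ball_mem_nhds x hr] with y hy
      refine hz.integral_eq_of_near hD.length_pos.le a (r := r) (fun t => ?_) ?_
      · rw [← map_sub, φ.norm_map]
        by_contra! hlt
        exact hD.notMem t (hball (by rwa [Metric.mem_ball, dist_eq_norm]))
      · rw [← map_sub, φ.norm_map, ← dist_eq_norm]
        exact hy
    exact hD.isOpen.is_const_of_fderiv_eq_zero (𝕜 := ℝ) hD.isPreconnected
      (fun x hx => (hN x hx).differentiableAt.differentiableWithinAt)
      (fun x hx => (hN x hx).fderiv) hx hy
  have hφd : φ d ≠ 0 := fun h => hd (by simpa using h)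
  refine hz.not_same_integral (hder α _ hc.hasDerivAt) hφd (fun h => ?_) hD.length_pos
    (fun t ht h => hD.ne_of_mem_Ioo hα ht (φ.injective h)) (d := φ d) ?_
  · refine htr (φ (deriv c α) / φ d).re (φ.injective ?_)
    rw [φ.map_smul, Complex.real_smul]
    have : ((φ (deriv c α) / φ d).re : ℂ) = φ (deriv c α) / φ d :=
      Complex.ext (by simp) (by simpa using h.symm)
    rw [this, div_mul_cancel₀ _ hφd]
  · filter_upwards [hside] with ε hε a
    have e1 : φ (c α) + ε * φ d = φ (c α + ε • d) := by
      rw [map_add, φ.map_smul, Complex.real_smul]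
    have e2 : φ (c α) - ε * φ d = φ (c α - ε • d) := by
      rw [map_sub, φ.map_smul, Complex.real_smul]
    rw [e1, e2]
    exact ⟨hne _ hε.1, hne _ hε.2, hconst a _ hε.1 _ hε.2⟩

end IsReferenceRegion

end RuledImmersion

/-! ### Curvature of the boundary and tangent rulings. -/

namespace RuledImmersion

variable {D : Set Plane} {χ : Plane → Space} {ℓ : ℝ} {c : ℝ → Plane}

theorem inner_rot (u v : Plane) : inner ℝ u (rot v) = u 1 * v 0 - u 0 * v 1 := by
  simp [PiLp.inner_apply, rot]
  ring

theorem inner_self_rot (u : Plane) : inner ℝ u (rot u) = 0 := by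
  rw [inner_rot]; ring

theorem norm_sq_eq (u : Plane) : ‖u‖ ^ 2 = u 0 ^ 2 + u 1 ^ 2 := by
  simp [EuclideanSpace.norm_sq_eq]

theorem inner_rot_rot (u : Plane) : inner ℝ (rot u) (rot u) = ‖u‖ ^ 2 := by
  rw [inner_rot, norm_sq_eq]; simp [rot]; ring

theorem continuous_rot : Continuous rot := by
  have : Continuous fun v : Plane => ![-(v 1), v 0] := by
    refine continuous_pi fun i => ?_
    fin_cases i <;> simp <;> fun_prop
  exact (PiLp.continuous_toLp 2 _).comp this

theorem eq_smul_of_inner_rot_eq_zero {τ u : Plane} (hτ : ‖τ‖ = 1) (h : inner ℝ u (rot τ) = 0) :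
    u = (inner ℝ u τ : ℝ) • τ := by
  have h1 := norm_sq_eq τ
  rw [hτ] at h1
  rw [inner_rot] at h
  have h2 : (inner ℝ u τ : ℝ) = u 0 * τ 0 + u 1 * τ 1 := by
    simp [PiLp.inner_apply]; ring
  rw [h2]
  ext i
  fin_cases i
  · simp only [Fin.zero_eta, PiLp.smul_apply, smul_eq_mul]
    linear_combination (u 0) * h1 - τ 1 * h
  · simp only [Fin.mk_one, PiLp.smul_apply, smul_eq_mul]
    linear_combination (u 1) * h1 + τ 0 * h

namespace IsReferenceRegion

theorem exists_finite_exceptional (hD : IsReferenceRegion D ℓ c) :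
    ∃ E : Set ℝ, E.Finite ∧ ∀ α ∈ Ico 0 ℓ \ E, ContDiffAt ℝ 2 c α ∧
      (deriv (deriv c) α ≠ 0 ∨ ∀ᶠ t in 𝓝 α, deriv (deriv c) t = 0) := by
  obtain ⟨B, hB, -, hBc⟩ := hD.exists_finite_breaks
  obtain ⟨S, hS, hord, hSeq⟩ := hD.curvature_zeros
  -- A zero of the curvature that is neither least nor greatest in its interval is interior to it,
  -- so the curvature vanishes nearby.
  refine ⟨B ∪ (sInf '' S ∪ sSup '' S), hB.union ((hS.image _).union (hS.image _)), ?_⟩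
  rintro α ⟨hα, hE⟩
  simp only [mem_union, not_or] at hE
  have hc := hBc α ⟨hα, hE.1⟩
  refine ⟨hc, or_iff_not_imp_left.2 fun h0 => ?_⟩
  rw [not_not] at h0
  have hmem : α ∈ ⋃₀ S := by
    rw [← hSeq]
    exact ⟨hα, hc, h0⟩
  obtain ⟨I, hI, hαI⟩ := hmem
  have hlow : ∃ x ∈ I, x < α := by
    by_contra! h
    exact hE.2.1 ⟨I, hI, IsLeast.csInf_eq ⟨hαI, h⟩⟩
  have hup : ∃ x ∈ I, α < x := by
    by_contra! h
    exact hE.2.2 ⟨I, hI, IsGreatest.csSup_eq ⟨hαI, h⟩⟩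
  obtain ⟨x, hx, hxα⟩ := hlow
  obtain ⟨y, hy, hαy⟩ := hup
  filter_upwards [Icc_mem_nhds hxα hαy] with t ht
  have : t ∈ ⋃₀ S := ⟨I, hI, (hord I hI).out hx hy ht⟩
  rw [← hSeq] at this
  exact this.2.2

theorem eventually_hasDerivAt {α : ℝ} (hc : ContDiffAt ℝ 2 c α) :
    ∀ᶠ t in 𝓝 α, HasDerivAt c (deriv c t) t ∧ HasDerivAt (deriv c) (deriv (deriv c) t) t := by
  filter_upwards [hc.eventually (by simp)] with t ht
  have h1 : ContDiffAt ℝ 1 (deriv c) t := ContDiffAt.derivWithin ht (by norm_num)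
  exact ⟨(ht.differentiableAt (by norm_num)).hasDerivAt,
    (h1.differentiableAt one_ne_zero).hasDerivAt⟩

/-- Unit speed makes the second derivative orthogonal to the tangent, so only its normal component
can be nonzero. -/
theorem inner_curvature_ne_zero (hD : IsReferenceRegion D ℓ c) {α : ℝ} (hc : ContDiffAt ℝ 2 c α)
    (h0 : deriv (deriv c) α ≠ 0) : inner ℝ (deriv (deriv c) α) (rot (deriv c α)) ≠ (0 : ℝ) := by
  intro h
  have hτ := hD.arclength α (hc.differentiableAt (by norm_num))
  have e := eq_smul_of_inner_rot_eq_zero hτ h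
  have h1 := (eventually_hasDerivAt hc).self_of_nhds.2
  have h2 := h1.inner ℝ h1
  have h3 := h2.unique ((hasDerivAt_const α (1 : ℝ)).congr_of_eventuallyEq (by
    filter_upwards [eventually_hasDerivAt hc] with t ht
    rw [real_inner_self_eq_norm_sq, hD.arclength t ht.1.differentiableAt, one_pow]))
  rw [real_inner_comm] at h3
  have h4 : inner ℝ (deriv (deriv c) α) (deriv c α) = (0 : ℝ) := by linarith
  rw [h4, zero_smul] at e
  exact h0 e

end IsReferenceRegion

theorem exists_mean_value {f f' : ℝ → ℝ} {a η s t : ℝ}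
    (h : ∀ x, |x - a| < η → HasDerivAt f (f' x) x) (hs : |s - a| < η) (ht : |t - a| < η)
    (hne : t ≠ s) : ∃ ξ, |ξ - a| < η ∧ 0 < (ξ - s) * (t - s) ∧ |ξ - s| < |t - s| ∧
      f t - f s = f' ξ * (t - s) := by
  rw [abs_lt] at hs ht
  rcases lt_or_gt_of_ne hne with hlt | hlt
  · have hd : ∀ x ∈ Icc t s, HasDerivAt f (f' x) x := fun x hx =>
      h x (abs_lt.2 ⟨by linarith [hx.1], by linarith [hx.2]⟩)
    obtain ⟨ξ, hξ, e⟩ := exists_hasDerivAt_eq_slope f f' hlt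
      (fun x hx => (hd x hx).continuousAt.continuousWithinAt)
      (fun x hx => hd x (Ioo_subset_Icc_self hx))
    refine ⟨ξ, abs_lt.2 ⟨by linarith [hξ.1], by linarith [hξ.2]⟩,
      mul_pos_of_neg_of_neg (by linarith [hξ.2]) (by linarith), ?_, ?_⟩
    · rw [abs_of_neg (by linarith [hξ.2]), abs_of_neg (by linarith)]; linarith [hξ.1]
    · rw [eq_div_iff (by linarith)] at e; linarith
  · have hd : ∀ x ∈ Icc s t, HasDerivAt f (f' x) x := fun x hx =>
      h x (abs_lt.2 ⟨by linarith [hx.1], by linarith [hx.2]⟩)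
    obtain ⟨ξ, hξ, e⟩ := exists_hasDerivAt_eq_slope f f' hlt
      (fun x hx => (hd x hx).continuousAt.continuousWithinAt)
      (fun x hx => hd x (Ioo_subset_Icc_self hx))
    refine ⟨ξ, abs_lt.2 ⟨by linarith [hξ.1], by linarith [hξ.2]⟩,
      mul_pos (by linarith [hξ.1]) (by linarith), ?_, ?_⟩
    · rw [abs_of_pos (by linarith [hξ.1]), abs_of_pos (by linarith)]; linarith [hξ.2]
    · rw [eq_div_iff (by linarith)] at e; linarith

theorem pos_of_second_deriv_pos {f f' f'' : ℝ → ℝ} {a η s t : ℝ}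
    (h : ∀ x, |x - a| < η → HasDerivAt f (f' x) x) (h' : ∀ x, |x - a| < η → HasDerivAt f' (f'' x) x)
    (hpos : ∀ x, |x - a| < η → 0 < f'' x) (hs : |s - a| < η) (ht : |t - a| < η)
    (hne : t ≠ s) (h0 : f s = 0) (h0' : f' s = 0) : 0 < f t := by
  obtain ⟨ξ, h1, h2, -, e⟩ := exists_mean_value h hs ht hne
  have hξ : ξ ≠ s := fun h => by rw [h] at h2; simp at h2
  obtain ⟨ζ, h3, -, -, e'⟩ := exists_mean_value h' hs h1 hξ
  rw [h0, sub_zero] at e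
  rw [h0', sub_zero] at e'
  rw [e, e', mul_assoc]
  exact mul_pos (hpos ζ h3) h2

theorem mem_of_segment_disjoint_frontier (hD : IsOpen D) {x y : Plane} (hx : x ∈ D)
    (h : ∀ z ∈ segment ℝ x y, z ∉ frontier D) : y ∈ D := by
  refine (convex_segment x y).isPreconnected.subset_of_closure_inter_subset hD
    ⟨x, left_mem_segment ℝ x y, hx⟩ (fun z hz => ?_) (right_mem_segment ℝ x y)
  by_contra hzD
  exact h z hz.2 (by rw [hD.frontier_eq]; exact ⟨hz.1, hzD⟩)

namespace IsReferenceRegion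

/-- Near a point of nonzero curvature the boundary is strictly on one side of its tangents. -/
theorem local_convexity (hD : IsReferenceRegion D ℓ c) {α : ℝ} (hc : ContDiffAt ℝ 2 c α)
    (h0 : deriv (deriv c) α ≠ 0) : ∃ η > 0, ∀ s t, |s - α| < η → |t - α| < η → t ≠ s →
      0 < inner ℝ (deriv (deriv c) α) (rot (deriv c α)) *
        inner ℝ (c t - c s) (rot (deriv c s)) := by
  have hκ := hD.inner_curvature_ne_zero hc h0
  set κ : ℝ := inner ℝ (deriv (deriv c) α) (rot (deriv c α)) with hκdef
  have hc1 : ContDiffAt ℝ 1 (deriv c) α := ContDiffAt.derivWithin hc (by norm_num)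
  have hc2 : ContDiffAt ℝ 0 (deriv (deriv c)) α := ContDiffAt.derivWithin hc1 (by norm_num)
  have hcont : ContinuousAt (fun z : ℝ × ℝ =>
      κ * inner ℝ (deriv (deriv c) z.1) (rot (deriv c z.2))) (α, α) := by
    refine continuousAt_const.mul (ContinuousAt.inner ?_ ?_)
    · exact ContinuousAt.comp (g := deriv (deriv c)) hc2.continuousAt continuousAt_fst
    · exact continuous_rot.continuousAt.comp
        (ContinuousAt.comp (g := deriv c) hc1.continuousAt continuousAt_snd)
  have hpos : ∀ᶠ z : ℝ × ℝ in 𝓝 (α, α),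
      0 < κ * inner ℝ (deriv (deriv c) z.1) (rot (deriv c z.2)) :=
    hcont.eventually (lt_mem_nhds (mul_self_pos.2 hκ))
  obtain ⟨η₁, hη₁, h1⟩ := Metric.eventually_nhds_iff.1 hpos
  obtain ⟨η₂, hη₂, h2⟩ := Metric.eventually_nhds_iff.1 (eventually_hasDerivAt hc)
  refine ⟨min η₁ η₂, lt_min hη₁ hη₂, fun s t hs ht hne => ?_⟩
  have hd : ∀ x, |x - α| < min η₁ η₂ → HasDerivAt c (deriv c x) x ∧
      HasDerivAt (deriv c) (deriv (deriv c) x) x := fun x hx =>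
    h2 (by rw [Real.dist_eq]; exact hx.trans_le (min_le_right _ _))
  refine pos_of_second_deriv_pos (f := fun t => κ * inner ℝ (c t - c s) (rot (deriv c s)))
    (f' := fun t => κ * inner ℝ (deriv c t) (rot (deriv c s)))
    (f'' := fun t => κ * inner ℝ (deriv (deriv c) t) (rot (deriv c s))) (a := α)
    (fun x hx => ?_) (fun x hx => ?_) (fun x hx => ?_) hs ht hne (by simp)
    (by simp [inner_self_rot])
  · have := (((hd x hx).1.sub_const (c s)).inner ℝ (hasDerivAt_const x (rot (deriv c s)))).const_mul κ
    simpa using this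
  · have := ((hd x hx).2.inner ℝ (hasDerivAt_const x (rot (deriv c s)))).const_mul κ
    simpa using this
  · refine @h1 (x, s) ?_
    rw [Prod.dist_eq, Real.dist_eq, Real.dist_eq]
    exact max_lt (hx.trans_le (min_le_left _ _)) (hs.trans_le (min_le_left _ _))

/-- By compactness and injectivity, the part of the curve with parameters away from `α` keeps a
positive distance from `c α`. -/
theorem frontier_near (hD : IsReferenceRegion D ℓ c) {α η : ℝ} (hα : α ∈ Ico 0 ℓ) (hη : 0 < η) :
    ∃ ρ > 0, ∀ z ∈ frontier D, ‖z - c α‖ < ρ → ∃ t, |t - α| < η ∧ c t = z := by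
  have hℓ := hD.length_pos
  obtain ⟨ε, hε, hεη, hεℓ⟩ : ∃ ε > 0, ε < η ∧ ε ≤ ℓ / 4 :=
    ⟨min (η / 2) (ℓ / 4), by positivity, (min_le_left _ _).trans_lt (by linarith),
      min_le_right _ _⟩
  have hne : (Icc (α + ε) (α - ε + ℓ)).Nonempty := nonempty_Icc.2 (by linarith)
  obtain ⟨t₀, ht₀, hmin⟩ := isCompact_Icc.exists_isMinOn hne
    (f := fun t => ‖c t - c α‖) (hD.continuous.sub continuous_const).norm.continuousOn
  refine ⟨‖c t₀ - c α‖, norm_pos_iff.2 (sub_ne_zero.2 (hD.ne_of_mem_Ioo hα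
    ⟨by linarith [ht₀.1], by linarith [ht₀.2]⟩)), fun z hz hlt => ?_⟩
  rw [← hD.image_eq] at hz
  obtain ⟨s, -, rfl⟩ := hz
  obtain ⟨t, ht, e⟩ := hD.periodic.exists_mem_Ico hℓ s (α - ε)
  refine ⟨t, ?_, e.symm⟩
  rw [e] at hlt
  have h1 : t < α + ε := by
    by_contra! h
    exact hlt.not_ge (hmin ⟨h, ht.2.le⟩)
  rw [abs_lt]
  constructor <;> linarith [ht.1]

/-- A ruling that is tangent to the boundary at a point of nonzero curvature has a continuation on
the other side of the point of tangency. -/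
theorem exists_opposite_of_tangent (hD : IsReferenceRegion D ℓ c) (hχ : IsIsometricImmersion D χ)
    {α r : ℝ} {q : Plane} (hα : α ∈ Ico 0 ℓ) (hc : ContDiffAt ℝ 2 c α)
    (h0 : deriv (deriv c) α ≠ 0) (h : IsRuling D χ (c α) q) (e : q - c α = r • deriv c α) :
    ∃ s : ℝ, 0 < s ∧ IsRuling D χ (c α) (c α + s • -(q - c α)) := by
  have hκ := hD.inner_curvature_ne_zero hc h0
  obtain ⟨η, hη, hconv⟩ := hD.local_convexity hc h0
  obtain ⟨ρ, hρ, hnear⟩ := hD.frontier_near hα hη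
  have hτ := hD.arclength α (hc.differentiableAt (by norm_num))
  set κ : ℝ := inner ℝ (deriv (deriv c) α) (rot (deriv c α))
  have hv : q - c α ≠ 0 := sub_ne_zero.2 h.ne.symm
  have hr : r ≠ 0 := by
    rintro rfl
    rw [zero_smul] at e
    exact hv e
  set v := q - c α with hvdef
  -- This sign points `σ • rot v` away from the boundary: its normal component times `κ` is `-(κ *
  -- r) ^ 2`.
  set σ := -(κ * r) with hσ
  have hσ0 : σ ≠ 0 := neg_ne_zero.2 (mul_ne_zero hκ hr)
  obtain ⟨δ, hδ, hδ1, hδρ⟩ : ∃ δ > 0, δ < 1 ∧ δ * (‖v‖ + ‖σ • rot v‖ + 1) < ρ := by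
    have hN : 0 < ‖v‖ + ‖σ • rot v‖ + 1 := by positivity
    refine ⟨min (1 / 2) (ρ / 2 / (‖v‖ + ‖σ • rot v‖ + 1)), by positivity,
      (min_le_left _ _).trans_lt (by norm_num), ?_⟩
    calc _ ≤ ρ / 2 / (‖v‖ + ‖σ • rot v‖ + 1) * (‖v‖ + ‖σ • rot v‖ + 1) :=
          mul_le_mul_of_nonneg_right (min_le_right _ _) hN.le
      _ = ρ / 2 := div_mul_cancel₀ _ hN.ne'
      _ < ρ := by linarith
  have hrot : rot v = r • rot (deriv c α) := by
    rw [e]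
    ext i
    fin_cases i <;> simp [rot]
  have hinner : ∀ x y : ℝ, inner ℝ (x • v + y • σ • rot v) (rot (deriv c α)) = y * σ * r := by
    intro x y
    rw [hrot, e, inner_add_left]
    simp only [inner_smul_left, inner_self_rot, inner_rot_rot, hτ]
    simp [mul_assoc]
  have hnot : ∀ x y : ℝ, |x| < δ → 0 ≤ y → y < δ → (x ≠ 0 ∨ y ≠ 0) →
      c α + x • v + y • σ • rot v ∉ frontier D := by
    intro x y hx hy hy' hne hfr
    have hlt : ‖c α + x • v + y • σ • rot v - c α‖ < ρ := by
      rw [add_assoc, add_sub_cancel_left]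
      refine (norm_add_le _ _).trans_lt (lt_of_le_of_lt ?_ hδρ)
      rw [norm_smul, norm_smul y, Real.norm_eq_abs, Real.norm_eq_abs, abs_of_nonneg hy]
      nlinarith [norm_nonneg v, norm_nonneg (σ • rot v)]
    obtain ⟨t, ht, hct⟩ := hnear _ hfr hlt
    have hz : c t - c α = x • v + y • σ • rot v := by rw [hct]; abel
    by_cases htα : t = α
    · rw [htα, sub_self] at hz
      have h1 := hinner x y
      rw [← hz, inner_zero_left] at h1
      have hy0 : y = 0 := by
        rcases mul_eq_zero.1 h1.symm with h2 | h2
        · exact (mul_eq_zero.1 h2).resolve_right hσ0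
        · exact absurd h2 hr
      rw [hy0, zero_smul, add_zero] at hz
      rcases hne with h3 | h3
      · exact hv ((smul_eq_zero.1 hz.symm).resolve_left h3)
      · exact h3 hy0
    · have h1 := hconv α t (by simpa using hη) ht htα
      rw [hz, hinner, hσ] at h1
      nlinarith [mul_nonneg hy (mul_self_nonneg (κ * r))]
  refine h.exists_opposite hχ hD.isOpen hD.isBounded hσ0 hδ hδ1 fun x y hx hy hy' hne => ?_
  have hb : c α + (δ / 2) • v ∈ D := h.mem (by linarith) (by linarith)
  have hd2 : |δ / 2| < δ := by rw [abs_of_pos (by linarith)]; linarith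
  -- The punctured half disc has no boundary points, so it suffices to reach each of its points from
  -- the ruling by segments; passing through this point of the axis avoids the puncture.
  have hmid : c α + (δ / 2) • σ • rot v ∈ D := by
    refine mem_of_segment_disjoint_frontier hD.isOpen hb ?_
    rintro _ ⟨a, b, ha, hb, hab, rfl⟩
    have e1 : a • (c α + (δ / 2) • v) + b • (c α + (δ / 2) • σ • rot v) =
        c α + (a * (δ / 2)) • v + (b * (δ / 2)) • σ • rot v := by
      rw [show a = 1 - b by linarith]; module
    rw [e1]
    refine hnot _ _ ?_ (by positivity) (by nlinarith) ?_
    · rw [abs_of_nonneg (by positivity)]; nlinarith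
    · by_cases h1 : a = 0
      · right
        have : b = 1 := by linarith
        rw [this]; linarith
      · left; positivity
  refine mem_of_segment_disjoint_frontier hD.isOpen hmid ?_
  rintro _ ⟨a, b, ha, hb, hab, rfl⟩
  have e1 : a • (c α + (δ / 2) • σ • rot v) + b • (c α + x • v + y • σ • rot v) =
      c α + (b * x) • v + (a * (δ / 2) + b * y) • σ • rot v := by
    rw [show a = 1 - b by linarith]; module
  rw [e1]
  refine hnot _ _ ?_ (by positivity) (by nlinarith) ?_
  · rw [abs_mul, abs_of_nonneg hb]
    nlinarith [abs_nonneg x]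
  · by_cases h1 : a = 0
    · have : b = 1 := by linarith
      rw [h1, this]
      simpa using hne
    · right
      have : 0 < a := lt_of_le_of_ne ha (Ne.symm h1)
      positivity

/-- No ruling is tangent to a straight part of the boundary. -/
theorem not_tangent_of_straight (hD : IsReferenceRegion D ℓ c) {α r : ℝ} {q : Plane}
    (hc : ContDiffAt ℝ 2 c α) (h0 : ∀ᶠ t in 𝓝 α, deriv (deriv c) t = 0)
    (h : IsRuling D χ (c α) q) (e : q - c α = r • deriv c α) : False := by
  obtain ⟨η, hη, hη'⟩ := Metric.eventually_nhds_iff_ball.1 (h0.and (eventually_hasDerivAt hc))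
  have hpre : IsPreconnected (Metric.ball α η) := (convex_ball α η).isPreconnected
  have hα : α ∈ Metric.ball α η := Metric.mem_ball_self hη
  have h1 : ∀ t ∈ Metric.ball α η, deriv c t = deriv c α := fun t ht =>
    Metric.isOpen_ball.is_const_of_deriv_eq_zero hpre
      (fun x hx => (hη' x hx).2.2.differentiableAt.differentiableWithinAt)
      (fun x hx => (hη' x hx).1) ht hα
  have hd : ∀ t ∈ Metric.ball α η, HasDerivAt (fun t => c t - t • deriv c α) 0 t := fun t ht => by
    have := (hη' t ht).2.1.sub ((hasDerivAt_id t).smul_const (deriv c α))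
    rw [h1 t ht, one_smul, sub_self] at this
    exact this
  -- The boundary is affine near `α`, so a tangent ruling would start along boundary points.
  have h2 : ∀ t ∈ Metric.ball α η, c t = c α + (t - α) • deriv c α := fun t ht => by
    have : c t - t • deriv c α = c α - α • deriv c α :=
      Metric.isOpen_ball.is_const_of_deriv_eq_zero hpre
        (fun x hx => (hd x hx).differentiableAt.differentiableWithinAt)
        (fun x hx => (hd x hx).deriv) ht hα
    rw [sub_smul, sub_eq_iff_eq_add.1 this]
    abel
  have hlim : Tendsto (fun s : ℝ => α + s * r) (𝓝[>] 0) (𝓝 α) := by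
    have : Tendsto (fun s : ℝ => α + s * r) (𝓝 0) (𝓝 (α + 0 * r)) :=
      Continuous.tendsto (by fun_prop) 0
    simpa using this.mono_left nhdsWithin_le_nhds
  obtain ⟨s, hs, hs1⟩ := ((hlim.eventually (Metric.ball_mem_nhds α hη)).and
    (Ioo_mem_nhdsGT (zero_lt_one' ℝ))).exists
  have := h.mem hs1.1 hs1.2
  rw [e, smul_smul] at this
  refine hD.notMem (α + s * r) ?_
  rwa [h2 _ hs, add_sub_cancel_left]

end IsReferenceRegion
end RuledImmersion

/-! ### Points of tangency are isolated. -/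

namespace RuledImmersion

variable {D : Set Plane} {χ : Plane → Space} {ℓ : ℝ} {c : ℝ → Plane}

/-- The parameters of the boundary points of nonzero curvature at which a ruling is tangent to the
boundary. -/
def tangentSet (D : Set Plane) (χ : Plane → Space) (ℓ : ℝ) (c : ℝ → Plane) : Set ℝ :=
  {α ∈ Ico 0 ℓ | ContDiffAt ℝ 2 c α ∧ deriv (deriv c) α ≠ 0 ∧
    ∃ q, IsRuling D χ (c α) q ∧ ∃ r : ℝ, q - c α = r • deriv c α}

namespace IsReferenceRegion

theorem exists_ruling_of_mem_tangentSet (hD : IsReferenceRegion D ℓ c)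
    (hχ : IsIsometricImmersion D χ) {α : ℝ} (hα : α ∈ tangentSet D χ ℓ c) {s : ℝ} (hs : s ≠ 0) :
    ∃ r : ℝ, 0 < r * s ∧ IsRuling D χ (c α) (c α + r • deriv c α) := by
  obtain ⟨hα, hc, h0, q, hq, r, e⟩ := hα
  have hr : r ≠ 0 := by
    rintro rfl
    rw [zero_smul, sub_eq_zero] at e
    exact hq.ne e.symm
  rcases lt_or_gt_of_ne (mul_ne_zero hr hs) with h | h
  · obtain ⟨t, ht, hrul⟩ := hD.exists_opposite_of_tangent hχ hα hc h0 hq e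
    refine ⟨-(t * r), by nlinarith, ?_⟩
    rwa [e, ← smul_neg, smul_smul, smul_neg, ← neg_smul] at hrul
  · refine ⟨r, h, ?_⟩
    rwa [← e, add_sub_cancel]

/-- The parameters at which a ruling is tangent to a curved part of the boundary are isolated. -/
theorem isolated_of_mem_tangentSet (hD : IsReferenceRegion D ℓ c)
    (hχ : IsIsometricImmersion D χ) {α : ℝ} (hα : α ∈ tangentSet D χ ℓ c) :
    ∀ᶠ β in 𝓝[≠] α, β ∉ tangentSet D χ ℓ c := by
  obtain ⟨hαI, hc, h0, -⟩ := id hα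
  have hκ := hD.inner_curvature_ne_zero hc h0
  obtain ⟨η, hη, hconv⟩ := hD.local_convexity hc h0
  obtain ⟨ρ, hρ, hnear⟩ := hD.frontier_near hαI hη
  set κ : ℝ := inner ℝ (deriv (deriv c) α) (rot (deriv c α))
  -- the tangent lines near `α` are rulings of uniform length
  have hline : ∀ β ∈ tangentSet D χ ℓ c, |β - α| < η → ‖c β - c α‖ < ρ / 2 → ∀ s : ℝ, s ≠ 0 →
      |s| < ρ / 2 → c β + s • deriv c β ∈ D ∧
        fderiv ℝ (fderiv ℝ χ) (c β + s • deriv c β) (deriv c β) = 0 ∧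
        fderiv ℝ (fderiv ℝ χ) (c β + s • deriv c β) ≠ 0 := by
    intro β hβ hβη hβρ s hs hsρ
    obtain ⟨r, hrs, hrul⟩ := hD.exists_ruling_of_mem_tangentSet hχ hβ hs
    have hτ := hD.arclength β (hβ.2.1.differentiableAt (by norm_num))
    have hr : r ≠ 0 := fun h => by simp [h] at hrs
    -- A ruling ending sooner would end at a boundary point near `c α`, but local convexity keeps
    -- such points off the tangent line at `β`.
    have hlt : |s| < |r| := by
      by_contra! hle
      have h1 : ‖c β + r • deriv c β - c α‖ < ρ := by
        have : c β + r • deriv c β - c α = (c β - c α) + r • deriv c β := by abel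
        rw [this]
        refine (norm_add_le _ _).trans_lt ?_
        rw [norm_smul, hτ, mul_one, Real.norm_eq_abs]
        linarith
      obtain ⟨t, ht, hct⟩ := hnear _ hrul.right_mem h1
      have hne : t ≠ β := by
        rintro rfl
        exact hrul.ne hct
      have := hconv β t hβη ht hne
      rw [hct, add_sub_cancel_left, inner_smul_left, inner_self_rot] at this
      simp at this
    have hsr : 0 < s / r := by
      rw [div_eq_mul_inv]
      have : s * r⁻¹ = (r * s) * (r⁻¹ * r⁻¹) := by field_simp
      rw [this]
      exact mul_pos hrs (mul_self_pos.2 (inv_ne_zero hr))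
    have hsr1 : s / r < 1 := by
      rw [← abs_of_pos hsr, abs_div, div_lt_one (abs_pos.2 hr)]
      exact hlt
    have ep : c β + (s / r) • (c β + r • deriv c β - c β) = c β + s • deriv c β := by
      rw [add_sub_cancel_left, smul_smul, div_mul_cancel₀ _ hr]
    have k1 := hrul.mem hsr hsr1
    have k2 := hrul.hess_dir hχ hD.isOpen hsr hsr1
    have k3 := hrul.hess_ne hsr hsr1
    rw [ep] at k1 k2 k3
    rw [add_sub_cancel_left, map_smul] at k2
    exact ⟨k1, clm_eq_zero_of_smul hr k2, k3⟩
  -- estimates for the tangent lines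
  have hτα := hD.arclength α (hc.differentiableAt (by norm_num))
  have hd2 : HasDerivAt (fun t => (inner ℝ (deriv c t) (rot (deriv c α)) : ℝ)) κ α := by
    have := (eventually_hasDerivAt hc).self_of_nhds.2.inner ℝ
      (hasDerivAt_const α (rot (deriv c α)))
    simpa using this
  have hasym : ∀ᶠ t in 𝓝 α,
      |inner ℝ (deriv c t) (rot (deriv c α)) - κ * (t - α)| ≤ |κ| / 2 * |t - α| := by
    have := (hasDerivAt_iff_isLittleO.1 hd2).bound (half_pos (abs_pos.2 hκ))
    refine this.mono fun t ht => ?_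
    rw [inner_self_rot, sub_zero, smul_eq_mul, mul_comm (t - α)] at ht
    exact ht
  obtain ⟨η', hη', hη'p⟩ := Metric.eventually_nhds_iff.1 (hasym.and (eventually_hasDerivAt hc))
  have hnorm : ∀ᶠ β in 𝓝 α, ‖c β - c α‖ < ρ / 4 := by
    have := hD.continuous.tendsto α
    simpa [dist_eq_norm] using (Metric.tendsto_nhds.1 this) (ρ / 4) (by positivity)
  rw [eventually_nhdsWithin_iff]
  filter_upwards [hnorm, Metric.ball_mem_nhds α hη, Metric.ball_mem_nhds α hη',
    Metric.ball_mem_nhds α (show 0 < ρ / 16 by positivity)] with β hβn hβη hβη' hβρ hne hβ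
  rw [Metric.mem_ball, Real.dist_eq] at hβη hβη' hβρ
  replace hne : β ≠ α := hne
  have hβα : 0 < |β - α| := abs_pos.2 (sub_ne_zero.2 hne)
  set τ := deriv c α
  set τ' := deriv c β
  have hκ' := abs_pos.2 hκ
  have hφ' : |κ| / 2 * |β - α| ≤ |inner ℝ τ' (rot τ)| := by
    have h1 := (hη'p (by rwa [Real.dist_eq] : dist β α < η')).1
    have h2 := abs_sub_abs_le_abs_sub (κ * (β - α)) (inner ℝ τ' (rot τ))
    rw [abs_sub_comm, abs_mul] at h2
    linarith
  have hφ'0 : inner ℝ τ' (rot τ) ≠ (0 : ℝ) := abs_pos.1 (lt_of_lt_of_le (by positivity) hφ')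
  have hφ : |inner ℝ (c β - c α) (rot τ)| ≤ 2 * |κ| * |β - α| * |β - α| := by
    obtain ⟨ξ, h1, -, h3, h4⟩ := exists_mean_value
      (f := fun t => (inner ℝ (c t - c α) (rot τ) : ℝ))
      (f' := fun t => inner ℝ (deriv c t) (rot τ)) (a := α) (η := η') (s := α) (t := β)
      (fun x hx => by
        have := (((hη'p (by rwa [Real.dist_eq])).2.1).sub_const (c α)).inner ℝ
          (hasDerivAt_const x (rot τ))
        simpa using this) (by simpa using hη') hβη' hne
    rw [sub_self, inner_zero_left, sub_zero] at h4
    rw [h4, abs_mul]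
    refine mul_le_mul_of_nonneg_right ?_ hβα.le
    have h5 := (hη'p (by rwa [Real.dist_eq] : dist ξ α < η')).1
    have h6 := abs_sub_abs_le_abs_sub (inner ℝ (deriv c ξ) (rot τ)) (κ * (ξ - α))
    rw [abs_mul] at h6
    nlinarith
  have hφ0 : inner ℝ (c β - c α) (rot τ) ≠ (0 : ℝ) := fun h => by
    have := hconv α β (by simpa using hη) hβη hne
    rw [h, mul_zero] at this
    exact lt_irrefl _ this
  -- the tangent lines at `α` and `β` meet
  set s : ℝ := -inner ℝ (c β - c α) (rot τ) / inner ℝ τ' (rot τ) with hs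
  have hs0 : s ≠ 0 := div_ne_zero (neg_ne_zero.2 hφ0) hφ'0
  have hsle : |s| ≤ 4 * |β - α| := by
    rw [hs, abs_div, abs_neg, div_le_iff₀ (abs_pos.2 hφ'0)]
    nlinarith
  have hP : inner ℝ (c β + s • τ' - c α) (rot τ) = (0 : ℝ) := by
    rw [add_sub_right_comm, inner_add_left, inner_smul_left, hs]
    simp only [conj_trivial]
    rw [div_mul_cancel₀ _ hφ'0, add_neg_cancel]
  have hPx := eq_smul_of_inner_rot_eq_zero hτα hP
  set x : ℝ := inner ℝ (c β + s • τ' - c α) τ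
  have hτβ := hD.arclength β (hβ.2.1.differentiableAt (by norm_num))
  have hx : |x| < ρ / 2 := by
    have h1 : |x| = ‖c β + s • τ' - c α‖ := by
      rw [hPx, norm_smul, hτα, mul_one, Real.norm_eq_abs]
    rw [h1, add_sub_right_comm]
    refine (norm_add_le _ _).trans_lt ?_
    rw [norm_smul, hτβ, mul_one, Real.norm_eq_abs]
    linarith
  -- Otherwise `c α` would lie on the tangent at `β`, against local convexity with the roles
  -- exchanged.
  have hx0 : x ≠ 0 := by
    intro h
    rw [h, zero_smul] at hPx
    have h1 := hconv β α hβη (by simpa using hη) (Ne.symm hne)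
    have h2 : c α - c β = s • τ' := by
      rw [← sub_eq_zero, ← neg_eq_zero, ← hPx]; abel
    rw [h2, inner_smul_left, inner_self_rot] at h1
    simp at h1
  have hPeq : c α + x • τ = c β + s • τ' := by
    rw [← hPx]; abel
  obtain ⟨-, a2, a3⟩ := hline α hα (by simpa using hη) (by simpa using hρ) x hx0 hx
  obtain ⟨b1, b2, -⟩ := hline β hβ hβη (by linarith) s hs0 (by linarith)
  rw [hPeq] at a2 a3
  have hτ0 : τ ≠ 0 := fun h => by simp [h] at hτα
  obtain ⟨a, b, e⟩ := exists_eq_smul_add_smul_rot hτ0 τ'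
  have hb : b ≠ 0 := by
    rintro rfl
    refine hφ'0 ?_
    rw [e, zero_smul, add_zero, inner_smul_left, inner_self_rot, mul_zero]
  have b3 : fderiv ℝ (fderiv ℝ χ) (c β + s • τ') (rot τ) = 0 := by
    have e1 : rot τ = b⁻¹ • (τ' - a • τ) := by
      rw [e, add_sub_cancel_left, smul_smul, inv_mul_cancel₀ hb, one_smul]
    rw [e1, map_smul, map_sub, map_smul, b2, a2]
    ext1 x
    simp
  exact a3 (hess_eq_zero_of_rot (hχ.hess_symm hD.isOpen b1) hτ0 a2 (by rw [b3]; rfl))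

/-- A subset of the line whose points are all isolated from the right is countable. -/
theorem countable_tangentSet (hD : IsReferenceRegion D ℓ c) (hχ : IsIsometricImmersion D χ) :
    (tangentSet D χ ℓ c).Countable := by
  refine Set.Countable.mono (fun α hα => ?_)
    (countable_setOfPred_isolated_right_within (s := tangentSet D χ ℓ c))
  refine And.intro hα ?_
  have h1 := hD.isolated_of_mem_tangentSet hχ hα
  rw [← empty_mem_iff_bot, mem_nhdsWithin_iff_eventually]
  rw [eventually_nhdsWithin_iff] at h1
  filter_upwards [h1] with β hβ hβ'
  exact hβ (mem_Ioi.1 hβ'.2).ne' hβ'.1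

end IsReferenceRegion
end RuledImmersion

/-! ### Transversality, null sets and the conclusion. -/

namespace RuledImmersion

variable {D : Set Plane} {χ : Plane → Space} {ℓ : ℝ} {c : ℝ → Plane}

theorem cross_cross_self (a b : Space) :
    cross (cross a b) a = (inner ℝ a a : ℝ) • b - (inner ℝ a b : ℝ) • a := by
  have key : ∀ x y : Space, (inner ℝ x y : ℝ) = x 0 * y 0 + x 1 * y 1 + x 2 * y 2 := fun x y => by
    simp only [PiLp.inner_apply, Fin.sum_univ_three, RCLike.inner_apply, conj_trivial]
    ring
  rw [key, key]
  ext i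
  fin_cases i <;> simp [cross, cross_apply] <;> ring

/-- All the rulings at `p` lie on one line, and each of its two rays carries at most one. -/
theorem IsRuling.countable_setOf (hχ : IsIsometricImmersion D χ) (hD : IsOpen D) (p : Plane) :
    {q | IsRuling D χ p q}.Countable := by
  rcases eq_empty_or_nonempty {q | IsRuling D χ p q} with h | ⟨q₀, h₀⟩
  · rw [h]; exact countable_empty
  have hsub : {q | IsRuling D χ p q} ⊆
      {q | IsRuling D χ p q ∧ ∃ r : ℝ, 0 < r ∧ q - p = r • (q₀ - p)} ∪
      {q | IsRuling D χ p q ∧ ∃ r : ℝ, r < 0 ∧ q - p = r • (q₀ - p)} := by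
    intro q hq
    obtain ⟨r, hr, e⟩ := IsRuling.parallel hχ hD h₀ hq
    rcases lt_or_gt_of_ne hr with h | h
    · exact Or.inr ⟨hq, r, h, e⟩
    · exact Or.inl ⟨hq, r, h, e⟩
  have key : ∀ {q q' : Plane} {r r' : ℝ}, IsRuling D χ p q → IsRuling D χ p q' → 0 < r' * r⁻¹ →
      q - p = r • (q₀ - p) → q' - p = r' • (q₀ - p) → q = q' := by
    intro q q' r r' h h' hr e e'
    have hr0 : r ≠ 0 := fun h0 => by simp [h0] at hr
    refine (h.eq_of_pos hD h' hr ?_).symm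
    rw [e', e, smul_smul, mul_assoc, inv_mul_cancel₀ hr0, mul_one]
  refine (Countable.union (Subsingleton.countable ?_) (Subsingleton.countable ?_)).mono hsub
  · rintro q ⟨h, r, hr, e⟩ q' ⟨h', r', hr', e'⟩
    exact key h h' (mul_pos hr' (inv_pos.2 hr)) e e'
  · rintro q ⟨h, r, hr, e⟩ q' ⟨h', r', hr', e'⟩
    exact key h h' (mul_pos_of_neg_of_neg hr' (inv_lt_zero.2 hr)) e e'

theorem volume_segment_eq_zero {p q : Plane} (hpq : p ≠ q) : volume (segment ℝ p q) = 0 := by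
  refine measure_mono_null (t := (line[ℝ, p, q] : Set Plane)) ?_
    (Measure.addHaar_affineSubspace volume _ fun htop => ?_)
  · rw [segment_eq_image_lineMap]
    rintro _ ⟨s, -, rfl⟩
    exact AffineMap.lineMap_mem_affineSpan_pair s p q
  · have h1 : rot (q - p) +ᵥ p ∈ line[ℝ, p, q] := by rw [htop]; trivial
    obtain ⟨r, hr⟩ := vadd_left_mem_affineSpan_pair.1 h1
    rw [vsub_eq_sub] at hr
    have h2 := inner_rot_rot (q - p)
    rw [← hr, inner_smul_left, hr, inner_self_rot, mul_zero] at h2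
    exact hpq (sub_eq_zero.1 (norm_eq_zero.1 (pow_eq_zero_iff two_ne_zero |>.1 h2.symm))).symm

theorem otherEnd_eq {α : ℝ} {q : Plane} (hα : ∃! q, IsRuling D χ (c α) q)
    (hq : IsRuling D χ (c α) q) : otherEnd D χ c α = q :=
  hα.unique (Classical.epsilon_spec hα.exists) hq

namespace IsReferenceRegion

/-- The derivative within the closure is not assumed unique at the boundary, so it is compared with
the limit gradient `Gp` only along the boundary curve and along the ruling. If these directions are
independent, they determine it, and `Gp` is an isometry, so the conormal component is nonzero. -/
theorem tangent_of_gm_eq_zero (hD : IsReferenceRegion D ℓ c) (hχ : IsIsometricImmersion D χ)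
    {α : ℝ} (hc : DifferentiableAt ℝ c α) {q : Plane} (hq : IsRuling D χ (c α) q)
    (he : otherEnd D χ c α = q) (hgm : gm D χ c α = 0) :
    ∃ r : ℝ, q - c α = r • deriv c α := by
  have hτ := hD.arclength α hc
  set τ := deriv c α with hτdef
  have hτ0 : τ ≠ 0 := fun h => by simp [h] at hτ
  obtain ⟨a, b, e⟩ := exists_eq_smul_add_smul_rot hτ0 (q - c α)
  by_cases hb : b = 0
  · exact ⟨a, by rw [e, hb, zero_smul, add_zero]⟩
  exfalso
  have hcl := frontier_subset_closure hq.left_mem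
  obtain ⟨Gp, -, -, hGp, -, hder, -⟩ := hχ.exists_boundary_jet hD.isOpen hcl
  have hiso := norm_map_of_tendsto hχ hcl hGp
  have hder1 : HasFDerivWithinAt χ (bdryGrad D χ c α) (closure D) (c α) :=
    hder.differentiableWithinAt.hasFDerivWithinAt
  have hcD : ∀ᶠ t in 𝓝 α, c t ∈ closure D :=
    Eventually.of_forall fun t => frontier_subset_closure (hD.mem_frontier t)
  have d1 : HasDerivAt (χ ∘ c) (Gp τ) α := hder.comp_hasDerivAt α hc.hasDerivAt hcD
  have d2 : HasDerivAt (χ ∘ c) (bdryGrad D χ c α τ) α :=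
    hder1.comp_hasDerivAt α hc.hasDerivAt hcD
  have eτ : bdryGrad D χ c α τ = Gp τ := d2.unique d1
  have hT : darbouxT χ c α = Gp τ := d1.deriv
  have eq : bdryGrad D χ c α (q - c α) = Gp (q - c α) := by
    have hl : HasDerivWithinAt (fun s : ℝ => c α + s • (q - c α)) (q - c α) (Icc 0 1) 0 := by
      have := ((hasDerivAt_id (0 : ℝ)).smul_const (q - c α)).const_add (c α)
      rw [one_smul] at this
      exact this.hasDerivWithinAt
    have hm : MapsTo (fun s : ℝ => c α + s • (q - c α)) (Icc 0 1) (closure D) := by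
      intro s hs
      rw [← closure_Ioo (zero_ne_one' ℝ)] at hs
      exact map_mem_closure (f := fun s : ℝ => c α + s • (q - c α)) (continuous_line _ _) hs
        fun s hs => hq.mem hs.1 hs.2
    have e0 : c α + (0 : ℝ) • (q - c α) = c α := by simp
    have g1 := HasFDerivWithinAt.comp_hasDerivWithinAt (0 : ℝ) (by rw [e0]; exact hder) hl hm
    have g2 := HasFDerivWithinAt.comp_hasDerivWithinAt (0 : ℝ) (by rw [e0]; exact hder1) hl hm
    exact (uniqueDiffOn_Icc zero_lt_one 0 ⟨le_rfl, zero_le_one⟩).eq_deriv _ g2 g1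
  have er : bdryGrad D χ c α (rot τ) = Gp (rot τ) := by
    have e1 : rot τ = b⁻¹ • ((q - c α) - a • τ) := by
      rw [e, add_sub_cancel_left, smul_smul, inv_mul_cancel₀ hb, one_smul]
    have lin (L : Plane →L[ℝ] Space) : L (rot τ) = b⁻¹ • (L (q - c α) - a • L τ) := by
      rw [e1, map_smul, map_sub L (q - c α) (a • τ), map_smul]
    rw [lin, lin, eq, eτ]
  -- Either choice of the inward normal is `±rot τ`, and the sign is irrelevant for the vanishing of
  -- the component.
  obtain ⟨ε, hε, hM⟩ : ∃ ε : ℝ, ε ≠ 0 ∧ inwardNormal D c α = ε • rot τ := by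
    unfold inwardNormal
    split_ifs
    · exact ⟨1, one_ne_zero, by rw [one_smul]⟩
    · exact ⟨-1, by norm_num, by rw [neg_one_smul]⟩
  have hin := inner_map_of_norm_map hiso
  have hMM : darbouxM D χ c α = Gp (ε • rot τ) := by
    unfold darbouxM darbouxN
    rw [hT, hM, map_smul, er, eτ, ← map_smul, cross_cross_self, hin, hin, inner_smul_right,
      inner_self_rot, mul_zero, zero_smul, sub_zero, real_inner_self_eq_norm_sq, hτ, one_pow,
      one_smul]
  have hlen : ‖q - c α‖⁻¹ ≠ 0 := inv_ne_zero (norm_ne_zero_iff.2 (sub_ne_zero.2 hq.ne.symm))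
  unfold gm imageDir rulingDir rulingLength at hgm
  rw [he, map_smul, eq, hMM, inner_smul_left, hin, inner_smul_right] at hgm
  generalize ‖q - c α‖⁻¹ = L at hgm hlen
  rw [e, inner_add_left,
    inner_smul_left, inner_smul_left, inner_self_rot, inner_rot_rot, hτ] at hgm
  simp [hlen, hε, hb] at hgm

/-- Away from finitely many parameters, a boundary point with a unique ruling has a ruling
transverse to the boundary. -/
theorem gm_ne_zero_of_curvature (hD : IsReferenceRegion D ℓ c) (hχ : IsIsometricImmersion D χ)
    {α : ℝ} (hα : α ∈ Ico 0 ℓ) (hc : ContDiffAt ℝ 2 c α)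
    (hcurv : deriv (deriv c) α ≠ 0 ∨ ∀ᶠ t in 𝓝 α, deriv (deriv c) t = 0)
    (huniq : ∃! q, IsRuling D χ (c α) q) : gm D χ c α ≠ 0 := by
  intro hgm
  obtain ⟨q, hq, hq'⟩ := id huniq
  obtain ⟨r, e⟩ := hD.tangent_of_gm_eq_zero hχ (hc.differentiableAt (by norm_num)) hq
    (otherEnd_eq huniq hq) hgm
  rcases hcurv with h | h
  · obtain ⟨s, hs, hrul⟩ := hD.exists_opposite_of_tangent hχ hα hc h hq e
    have e1 := hq' _ hrul
    have e2 : (1 + s) • (q - c α) = 0 := by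
      have e3 : s • -(q - c α) = q - c α := by
        rw [eq_sub_iff_add_eq, add_comm]; exact e1
      rw [add_smul, one_smul]
      nth_rewrite 1 [← e3]
      rw [smul_neg, neg_add_cancel]
    rcases smul_eq_zero.1 e2 with h1 | h1
    · linarith
    · exact hq.ne (sub_eq_zero.1 h1).symm
  · exact hD.not_tangent_of_straight hc h hq e

/-- Away from finitely many parameters, a boundary point with several rulings is a point of
tangency. -/
theorem mem_tangentSet_of_not_unique (hD : IsReferenceRegion D ℓ c)
    (hχ : IsIsometricImmersion D χ) {α : ℝ} (hα : α ∈ Ico 0 ℓ) (hc : ContDiffAt ℝ 2 c α)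
    (hcurv : deriv (deriv c) α ≠ 0 ∨ ∀ᶠ t in 𝓝 α, deriv (deriv c) t = 0) {q : Plane}
    (hq : IsRuling D χ (c α) q) (hnot : ¬ ∃! q, IsRuling D χ (c α) q) :
    α ∈ tangentSet D χ ℓ c := by
  have hdiff := hc.differentiableAt (n := 2) (by norm_num)
  obtain ⟨q', hq', hne⟩ : ∃ q', IsRuling D χ (c α) q' ∧ q' ≠ q := by
    by_contra! h
    exact hnot ⟨q, hq, h⟩
  obtain ⟨r, hr, e⟩ := hq.parallel hχ hD.isOpen hq'
  have hr0 : r < 0 := lt_of_le_of_ne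
    (not_lt.1 fun h => hne (hq.eq_of_pos hD.isOpen hq' h e)) hr
  -- Two opposite rulings transverse to the boundary would place `D` on both sides of `c α`.
  have htan : ∃ s : ℝ, q - c α = s • deriv c α := by
    by_contra! h
    refine hD.not_both_sides hα hdiff (sub_ne_zero.2 hq.ne.symm) (fun s hs => ?_) ?_
    · have hs0 : s ≠ 0 := by
        rintro rfl
        have := hD.arclength α hdiff
        rw [hs, zero_smul, norm_zero] at this
        exact zero_ne_one this
      exact h s⁻¹ (by rw [hs, smul_smul, inv_mul_cancel₀ hs0, one_smul])
    · filter_upwards [Ioo_mem_nhdsGT (zero_lt_one' ℝ), Ioo_mem_nhdsGT (neg_pos.2 hr0)]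
        with ε h1 h2
      refine ⟨hq.mem h1.1 h1.2, ?_⟩
      have := hq'.mem (s := ε / -r) (div_pos h1.1 (neg_pos.2 hr0))
        ((div_lt_one (neg_pos.2 hr0)).2 h2.2)
      rw [e, smul_smul, div_neg, neg_mul, div_mul_cancel₀ _ hr, neg_smul, ← sub_eq_add_neg] at this
      exact this
  obtain ⟨s, hs⟩ := htan
  refine ⟨hα, hc, hcurv.resolve_right fun h => ?_, q, hq, s, hs⟩
  exact hD.not_tangent_of_straight hc h hq hs

end IsReferenceRegion

theorem mem_image_paramSet {A : Set ℝ} {α : ℝ} {x : Plane} (hα : α ∈ A)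
    (hx : x ∈ segment ℝ (c α) (otherEnd D χ c α)) (hne : c α ≠ otherEnd D χ c α) :
    x ∈ xHat D χ c '' paramSet D χ c A := by
  obtain ⟨a, b, ha, hb, hab, rfl⟩ := hx
  have hlen : ‖otherEnd D χ c α - c α‖ ≠ 0 := norm_ne_zero_iff.2 (sub_ne_zero.2 hne.symm)
  refine ⟨(α, b * rulingLength D χ c α), ⟨hα, ?_, ?_⟩, ?_⟩
  · exact mul_nonneg hb (norm_nonneg _)
  · exact mul_le_of_le_one_left (norm_nonneg _) (by linarith)
  · simp only [xHat, rulingDir, rulingLength]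
    rw [smul_smul, mul_assoc, mul_inv_cancel₀ hlen, mul_one, show a = 1 - b by linarith]
    module

theorem image_paramSet_subset {A : Set ℝ} (hA : ∀ α ∈ A, ∃ q, IsRuling D χ (c α) q) :
    xHat D χ c '' paramSet D χ c A ⊆ curvedPart D χ := by
  rintro _ ⟨⟨α, β⟩, ⟨hα, hβ0, hβ1⟩, rfl⟩
  have hq : IsRuling D χ (c α) (otherEnd D χ c α) := Classical.epsilon_spec (hA α hα)
  have hlen : 0 < ‖otherEnd D χ c α - c α‖ := norm_pos_iff.2 (sub_ne_zero.2 hq.ne.symm)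
  simp only [rulingLength] at hβ0 hβ1
  refine ⟨_, _, hq, 1 - β / ‖otherEnd D χ c α - c α‖, β / ‖otherEnd D χ c α - c α‖, ?_,
    by positivity, by ring, ?_⟩
  · rw [sub_nonneg]; exact (div_le_one hlen).2 hβ1
  · simp only [xHat, rulingDir, rulingLength, smul_smul, div_eq_mul_inv]
    module

end RuledImmersion

open RuledImmersion
theorem mainTheorem4 (D : Set Plane) (ℓ : ℝ) (c : ℝ → Plane) (χ : Plane → Space)
    (hD : IsReferenceRegion D ℓ c) (hχ : IsIsometricImmersion D χ) :
    {α ∈ rulingSet D χ ℓ c \ singularSet ℓ c | gm D χ c α = 0}.Finite ∧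
    xHat D χ c '' paramSet D χ c (regularSet D χ ℓ c) ⊆ curvedPart D χ ∧
    volume (curvedPart D χ \ xHat D χ c '' paramSet D χ c (regularSet D χ ℓ c)) = 0 := by
  obtain ⟨E, hE, hEc⟩ := hD.exists_finite_exceptional
  refine ⟨hE.subset ?_, image_paramSet_subset fun α hα => hα.1.1.2.exists, ?_⟩
  · rintro α ⟨⟨hα, -⟩, hgm⟩
    by_contra hαE
    obtain ⟨hc, hcurv⟩ := hEc α ⟨hα.1, hαE⟩
    exact hD.gm_ne_zero_of_curvature hχ hα.1 hc hcurv hα.2 hgm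
  let good : ℝ → Prop := fun α => α ∈ rulingSet D χ ℓ c \ singularSet ℓ c ∧ gm D χ c α ≠ 0
  let bad : Set ℝ := {α | α ∈ Ico 0 ℓ ∧ (∃ q, IsRuling D χ (c α) q) ∧ ¬ good α}
  have hbad : bad.Countable := by
    refine (hE.countable.union (hD.countable_tangentSet hχ)).mono ?_
    rintro α ⟨hα, ⟨q, hq⟩, hng⟩
    by_cases hαE : α ∈ E
    · exact Or.inl hαE
    obtain ⟨hc, hcurv⟩ := hEc α ⟨hα, hαE⟩
    refine Or.inr (hD.mem_tangentSet_of_not_unique hχ hα hc hcurv hq fun huniq => hng ?_)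
    exact ⟨⟨⟨hα, huniq⟩, fun h => h.2 (hc.differentiableAt (by norm_num))⟩,
      hD.gm_ne_zero_of_curvature hχ hα hc hcurv huniq⟩
  have hnull : volume (⋃ α ∈ bad, ⋃ q ∈ {q | IsRuling D χ (c α) q}, segment ℝ (c α) q) = 0 := by
    refine (measure_biUnion_null_iff hbad).2 fun α _ => ?_
    refine (measure_biUnion_null_iff (IsRuling.countable_setOf hχ hD.isOpen (c α))).2
      fun q hq => volume_segment_eq_zero hq.ne
  refine measure_mono_null ?_ hnull
  rintro x ⟨⟨p, q, hpq, hx⟩, hnx⟩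
  obtain ⟨α, hα, rfl⟩ : p ∈ c '' Ico 0 ℓ := by rw [hD.image_eq]; exact hpq.left_mem
  obtain ⟨β, hβ, rfl⟩ : q ∈ c '' Ico 0 ℓ := by rw [hD.image_eq]; exact hpq.right_mem
  -- A ruling with two good ends is in the image of the parametrization, so an uncovered point lies
  -- on a ruling with a bad end.
  by_cases hgα : good α
  · have he := otherEnd_eq hgα.1.1.2 hpq
    have hlen : ‖c β - c α‖ ≠ 0 := norm_ne_zero_iff.2 (sub_ne_zero.2 hpq.ne.symm)
    have hμ : mu D χ ℓ c α = β := by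
      have e : c α + rulingLength D χ c α • rulingDir D χ c α = c β := by
        simp only [rulingDir, rulingLength, he]
        rw [smul_smul, mul_inv_cancel₀ hlen, one_smul, add_sub_cancel]
      unfold mu
      rw [e]
      exact hD.injOn.leftInvOn_invFunOn hβ
    by_cases hgβ : good β
    · refine absurd (mem_image_paramSet (D := D) (χ := χ) (c := c) (α := α) ?_ ?_ ?_) hnx
      · exact ⟨hgα.1, hgα.2, by rw [hμ]; exact hgβ⟩
      · rwa [he]
      · rw [he]; exact hpq.ne
    · refine mem_iUnion₂.2 ⟨β, ⟨hβ, ⟨_, hpq.symm⟩, hgβ⟩, mem_iUnion₂.2 ⟨c α, hpq.symm, ?_⟩⟩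
      rwa [segment_symm]
  · exact mem_iUnion₂.2 ⟨α, ⟨hα, ⟨_, hpq⟩, hgα⟩, mem_iUnion₂.2 ⟨c β, hpq, hx⟩⟩
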